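/- A \emph{squares category} $\mathcal{D}$ is a small double category whose 2-cells (the \emph{distinguished squares}) are determined by their boundaries, with category of horizontal morphisms $\mathcal{M}_{\mathcal D}$ and category of vertical morphisms $\mathcal{E}_{\mathcal D}$, together with an object $O$ that is initial in both $\mathcal{M}_{\mathcal D}$ and $\mathcal{E}_{\mathcal D}$. Let $T_n\mathcal{D}$ be the category whose objects are the functors $F\colon[n]\to\mathcal{M}_{\mathcal D}$ and whose morphisms $F\Rightarrow G$ are families of vertical morphisms $F(i)\to G(i)$ such that for all $i\le j$ the square formed by $F(i)\to F(j)$, $G(i)\to G(j)$ and the two vertical morphisms is distinguished. Precomposition makes $T_\bullet\mathcal{D}$ a simplicial category, and \[K^\square(\mathcal{D})=\Omega_O|N_\bullet T_\bullet\mathcal{D}|.\] Let $\mathcal{C}$ be a small Waldhausen category, i.e. a category with a chosen zero object $*$, a subcategory of cofibrations and a subcategory of weak equivalences, both containing all isomorphisms, such that all maps $*\to A$ are cofibrations, pushouts along cofibrations exist and cofibrations are stable under them, and the gluing axiom holds. Let $wS_n\mathcal{C}$ be the category of diagrams $A\colon \mathrm{Ar}[n]\to\mathcal{C}$ with $A_{j,j}=*$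 such that, for $i\le j\le k$, the map $A_{i,j}\to A_{i,k}$ is a cofibration and the square on $A_{i,j},A_{i,k},A_{j,j},A_{j,k}$ is a pushout; its morphisms are the natural transformations all of whose components are weak equivalences. Waldhausen's $K$-theory is $K^W(\mathcal{C})=\Omega|N_\bullet wS_\bullet\mathcal{C}|$, with the loops based at the vertex given by the unique object of $wS_0\mathcal{C}$. Let $\mathcal{C}'$ be the squares category with the same objects as $\mathcal{C}$, whose horizontal morphisms are the cofibrations, whose vertical morphisms are all morphisms of $\mathcal{C}$, whose distinguished squares are the commutative squares \[\begin{array}{ccc}A&\rightarrowtail&B\\ \downarrow&&\downarrow\\ C&\rightarrowtail&D\end{array}\] for which the induced map $B\cup_A C\to D$ is a weak equivalence, and whose base object $O$ is the zero object. Then \[K^W(\mathcal{C})\simeq K^\square(\mathcal{C}')\] as loop spaces: there is a based continuous map $|N_\bullet wS_\bullet\mathcal{C}|\to|N_\bullet T_\bullet\mathcal{C}'|$ whose loop map $K^W(\mathcal{C})\to K^\square(\mathcal{C}')$ is a homotopy equivalence. -/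

import Mathlib

open CategoryTheory Opposite Simplicial ContinuousMap

universe v u

/-! ### Simple double categories and squares categories -/

/-- A (small) double category on the objects `Ob` in which a 2-cell is determined by its boundary.
`hor` is the category of horizontal morphisms `A ↣ B`, `ver` the category of vertical morphisms,
and `IsDist f f' g g'` says that the square
```
A --f--> B
|g       |g'
C --f'-> D
```
is distinguished. -/
structure SimpleDoubleCategory (Ob : Type u) where
  hor : Category.{v} Ob
  ver : Category.{v} Ob
  IsDist : ∀ {A B C D : Ob},
    hor.Hom A B → hor.Hom C D → ver.Hom A C → ver.Hom B D → Prop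
  dist_vcomp : ∀ {A B C D E F : Ob} {f : hor.Hom A B} {f' : hor.Hom C D} {f'' : hor.Hom E F}
    {g : ver.Hom A C} {g' : ver.Hom B D} {k : ver.Hom C E} {k' : ver.Hom D F},
    IsDist f f' g g' → IsDist f' f'' k k' → IsDist f f'' (ver.comp g k) (ver.comp g' k')
  dist_hcomp : ∀ {A B C D E F : Ob} {f : hor.Hom A B} {h : hor.Hom B C} {f' : hor.Hom D E}
    {h' : hor.Hom E F} {g : ver.Hom A D} {g' : ver.Hom B E} {g'' : ver.Hom C F},
    IsDist f f' g g' → IsDist h h' g' g'' → IsDist (hor.comp f h) (hor.comp f' h') g g''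
  dist_ver_id : ∀ {A B : Ob} (f : hor.Hom A B), IsDist f f (ver.id A) (ver.id B)
  dist_hor_id : ∀ {A B : Ob} (g : ver.Hom A B), IsDist (hor.id A) (hor.id B) g g

/-- A squares category: a simple double category with a chosen object that is initial both
horizontally and vertically. -/
structure SquaresCategory (Ob : Type u) extends SimpleDoubleCategory.{v} Ob where
  base : Ob
  base_hor_initial : Nonempty (@Limits.IsInitial Ob hor base)
  base_ver_initial : Nonempty (@Limits.IsInitial Ob ver base)

namespace SquaresCategory

variable {Ob : Type u} (S : SquaresCategory.{v} Ob)

/-- The objects, regarded as the objects of the category of horizontal morphisms. -/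
def Hor (_ : SquaresCategory.{v} Ob) : Type u := Ob

instance : Category.{v} S.Hor := S.hor

/-- Horizontal functors from `D` to `S`. -/
structure HFun (D : Type) [Category.{0} D] where
  functor : D ⥤ S.Hor

variable {S}

/-- Vertical distinguished transformations between horizontal functors. -/
@[ext]
structure HFun.Hom {D : Type} [Category.{0} D] (F G : S.HFun D) where
  app : ∀ d : D, S.ver.Hom (F.functor.obj d) (G.functor.obj d)
  dist : ∀ {d d' : D} (f : d ⟶ d'),
    S.IsDist (F.functor.map f) (G.functor.map f) (app d) (app d')

/-- The category of horizontal functors and vertical distinguished transformations. -/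
instance (D : Type) [Category.{0} D] : Category.{v} (S.HFun D) where
  Hom F G := HFun.Hom F G
  id F := ⟨fun d => S.ver.id (F.functor.obj d), fun _ => S.dist_ver_id _⟩
  comp α β := ⟨fun d => S.ver.comp (α.app d) (β.app d),
    fun f => S.dist_vcomp (α.dist f) (β.dist f)⟩
  id_comp _ := HFun.Hom.ext (funext fun _ => S.ver.id_comp _)
  comp_id _ := HFun.Hom.ext (funext fun _ => S.ver.comp_id _)
  assoc _ _ _ := HFun.Hom.ext (funext fun _ => S.ver.assoc _ _ _)

/-- Restriction of horizontal functors along a functor `D ⥤ D'`. -/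
def HFun.precomp {D D' : Type} [Category.{0} D] [Category.{0} D'] (G : D ⥤ D') :
    S.HFun D' ⥤ S.HFun D where
  obj F := ⟨G ⋙ F.functor⟩
  map α := ⟨fun d => α.app (G.obj d), fun f => α.dist (G.map f)⟩

variable (S)

/-- The simplicial category `T_• S`, with `T_n S` the category of horizontal functors
`[n] ⟶ S`. -/
def T : SimplexCategoryᵒᵖ ⥤ Cat.{v, max u v} where
  obj n := Cat.of (S.HFun (Fin (n.unop.len + 1)))
  map θ := (HFun.precomp θ.unop.toOrderHom.monotone.functor).toCatHom
  map_id _ := rfl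
  map_comp _ _ := rfl

/-- The base object, as an object of `T_0 S`. -/
def baseT₀ : S.T.obj (op ⦋0⦌) :=
  HFun.mk ((Functor.const (Fin 1)).obj (show S.Hor from S.base))

end SquaresCategory

/-! ### Realizations of simplicial categories -/

/-- The diagonal of a bisimplicial set. -/
def SSet.diagonal (X : SimplexCategoryᵒᵖ ⥤ SSet.{u}) : SSet.{u} where
  obj n := (X.obj n).obj n
  map θ := (X.map θ).app _ ≫ (X.obj _).map θ
  map_id n := by simp
  map_comp θ θ' := by simp

/-- The diagonal of the levelwise nerve of a simplicial category. -/
def SimplicialCat.diagNerve (X : SimplexCategoryᵒᵖ ⥤ Cat.{v, u}) : SSet.{max u v} :=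
  SSet.diagonal (X ⋙ nerveFunctor)

/-- The geometric realization `|N_• X_•|` of a simplicial category. -/
noncomputable def SimplicialCat.realization (X : SimplexCategoryᵒᵖ ⥤ Cat.{v, u}) :
    TopCat.{max u v} :=
  SSet.toTop.obj (SimplicialCat.diagNerve X)

/-- The point of `|Y|` given by a vertex of `Y`. -/
noncomputable def SSet.vertexPoint (Y : SSet.{u}) (y : Y.obj (op ⦋0⦌)) : SSet.toTop.obj Y :=
  TopCat.toSSetObj₀Equiv ((sSetTopAdj.unit.app Y).app (op ⦋0⦌) y)

/-- The point of `|N_• X_•|` given by an object of `X_0`. -/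
noncomputable def SimplicialCat.point (X : SimplexCategoryᵒᵖ ⥤ Cat.{v, u})
    (x : X.obj (op ⦋0⦌)) : SimplicialCat.realization X :=
  SSet.vertexPoint (SimplicialCat.diagNerve X) (ComposableArrows.mk₀ x)

/-! ### Squares K-theory -/

namespace SquaresCategory

variable {Ob : Type u} (S : SquaresCategory.{v} Ob)

/-- The point `O` of `|N_• T_• S|`. -/
noncomputable def basePoint : SimplicialCat.realization S.T := SimplicialCat.point S.T S.baseT₀

/-- The K-theory space `Ω_O |N_• T_• S|` of a squares category, with the compact-open topology. -/
abbrev K : Type (max u v) := LoopSpace (SimplicialCat.realization S.T) S.basePoint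

end SquaresCategory

/-! ### Waldhausen categories -/

/-- The structure of a Waldhausen category (a category with cofibrations and weak equivalences)
on a category `C`. -/
structure WaldhausenCategory (C : Type u) [Category.{v} C] where
  /-- the distinguished zero object -/
  zero : C
  isZero_zero : Limits.IsZero zero
  /-- the cofibrations -/
  cof : MorphismProperty C
  cof_of_isIso : ∀ {A B : C} (f : A ⟶ B) [IsIso f], cof f
  cof_comp : ∀ {A B D : C} (f : A ⟶ B) (g : B ⟶ D), cof f → cof g → cof (f ≫ g)
  cof_from_zero : ∀ {A : C} (f : zero ⟶ A), cof f
  hasPushout : ∀ {A B D : C} (f : A ⟶ B) (g : A ⟶ D), cof f → Limits.HasPushout f g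
  cof_pushout : ∀ {A B D P : C} {f : A ⟶ B} {g : A ⟶ D} {inl : B ⟶ P} {inr : D ⟶ P},
    IsPushout f g inl inr → cof f → cof inr
  /-- the weak equivalences -/
  weq : MorphismProperty C
  weq_of_isIso : ∀ {A B : C} (f : A ⟶ B) [IsIso f], weq f
  weq_comp : ∀ {A B D : C} (f : A ⟶ B) (g : B ⟶ D), weq f → weq g → weq (f ≫ g)
  /-- the gluing axiom: a map of spans `(B ↢ A ⟶ D) ⟶ (B' ↢ A' ⟶ D')` consisting of weak
  equivalences induces a weak equivalence between the pushouts -/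
  gluing : ∀ {A B D P A' B' D' P' : C} {f : A ⟶ B} {g : A ⟶ D} {inl : B ⟶ P} {inr : D ⟶ P}
    {f' : A' ⟶ B'} {g' : A' ⟶ D'} {inl' : B' ⟶ P'} {inr' : D' ⟶ P'}
    {a : A ⟶ A'} {b : B ⟶ B'} {d : D ⟶ D'} {p : P ⟶ P'},
    IsPushout f g inl inr → IsPushout f' g' inl' inr' → cof f → cof f' →
    f ≫ b = a ≫ f' → g ≫ d = a ≫ g' → inl ≫ p = b ≫ inl' → inr ≫ p = d ≫ inr' →
    weq a → weq b → weq d → weq p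

namespace WaldhausenCategory

variable {C : Type u} [Category.{v} C] (W : WaldhausenCategory C)

/-! #### The associated squares category -/

/-- A square with horizontal cofibrations `f`, `f'` and vertical morphisms `g`, `g'` is
distinguished if it commutes and the induced map `B ∪_A D ⟶ E` is a weak equivalence. -/
def IsDist {A B D E : C} (f : A ⟶ B) (f' : D ⟶ E) (g : A ⟶ D) (g' : B ⟶ E) : Prop :=
  ∃ w : f ≫ g' = g ≫ f', ∀ {P : C} {inl : B ⟶ P} {inr : D ⟶ P} (h : IsPushout f g inl inr),
    W.weq (h.desc g' f' w)

variable {W}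

lemma IsDist.mk_of {A B D E : C} {f : A ⟶ B} {f' : D ⟶ E} {g : A ⟶ D} {g' : B ⟶ E} {P : C}
    {inl : B ⟶ P} {inr : D ⟶ P} (h : IsPushout f g inl inr) (t : P ⟶ E)
    (hl : inl ≫ t = g') (hr : inr ≫ t = f') (ht : W.weq t) : W.IsDist f f' g g' := by
  have w : f ≫ g' = g ≫ f' := by rw [← hl, ← hr, h.w_assoc]
  refine ⟨w, fun {P'} inl' inr' h' => ?_⟩
  have e : h'.desc g' f' w = (h'.isoIsPushout _ _ h).hom ≫ t := by
    apply h'.hom_ext <;> simp [hl, hr]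
  rw [e]
  exact W.weq_comp _ _ (W.weq_of_isIso _) ht

lemma IsDist.exists_of {A B D E : C} {f : A ⟶ B} {f' : D ⟶ E} {g : A ⟶ D} {g' : B ⟶ E}
    (H : W.IsDist f f' g g') (hf : W.cof f) :
    ∃ (P : C) (inl : B ⟶ P) (inr : D ⟶ P) (_ : IsPushout f g inl inr) (t : P ⟶ E),
      inl ≫ t = g' ∧ inr ≫ t = f' ∧ W.weq t := by
  have := W.hasPushout f g hf
  obtain ⟨w, H⟩ := H
  have h := IsPushout.of_hasPushout f g
  exact ⟨_, _, _, h, h.desc g' f' w, by simp, by simp, H h⟩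

lemma IsDist.vcomp {A B D E F G : C} {f : A ⟶ B} {f' : D ⟶ E} {f'' : F ⟶ G}
    {g : A ⟶ D} {g' : B ⟶ E} {k : D ⟶ F} {k' : E ⟶ G} (hf : W.cof f) (hf' : W.cof f')
    (H : W.IsDist f f' g g') (H' : W.IsDist f' f'' k k') :
    W.IsDist f f'' (g ≫ k) (g' ≫ k') := by
  obtain ⟨P, inl, inr, h, t, hl, hr, ht⟩ := H.exists_of hf
  obtain ⟨Q, inl', inr', h', t', hl', hr', ht'⟩ := H'.exists_of hf'
  have hi : W.cof inr := W.cof_pushout h hf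
  have := W.hasPushout inr k hi
  have hR := IsPushout.of_hasPushout inr k
  -- the pushout of `f` along `g ≫ k`
  have hRR := h.flip.paste_horiz hR.flip
  let s : Limits.pushout inr k ⟶ Q := hR.desc (t ≫ inl') inr' (by
    rw [← Category.assoc, hr, h'.w])
  have hs : W.weq s := W.gluing hR h' hi hf' (a := 𝟙 D) (b := t) (d := 𝟙 F) (p := s)
    (by simp [hr]) (by simp) (by simp [s]) (by simp [s])
    (W.weq_of_isIso _) ht (W.weq_of_isIso _)
  refine IsDist.mk_of hRR.flip (s ≫ t') ?_ ?_ (W.weq_comp _ _ hs ht')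
  · simp [s, hl', reassoc_of% hl]
  · simp [s, hr']

lemma IsDist.hcomp {A B D E F G : C} {f : A ⟶ B} {h : B ⟶ D} {f' : E ⟶ F} {h' : F ⟶ G}
    {g : A ⟶ E} {g' : B ⟶ F} {g'' : D ⟶ G} (hf : W.cof f) (hh : W.cof h)
    (H : W.IsDist f f' g g') (H' : W.IsDist h h' g' g'') :
    W.IsDist (f ≫ h) (f' ≫ h') g g'' := by
  obtain ⟨P, inl, inr, hP, t, hl, hr, ht⟩ := H.exists_of hf
  obtain ⟨Q, inl', inr', hQ, t', hl', hr', ht'⟩ := H'.exists_of hh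
  have := W.hasPushout h inl hh
  have hR := IsPushout.of_hasPushout h inl
  let s : Limits.pushout h inl ⟶ Q := hR.desc inl' (t ≫ inr') (by
    rw [← Category.assoc, hl, hQ.w])
  have hs : W.weq s := W.gluing hR hQ hh hh (a := 𝟙 B) (b := 𝟙 D) (d := t) (p := s)
    (by simp) (by simp [hl]) (by simp [s]) (by simp [s])
    (W.weq_of_isIso _) (W.weq_of_isIso _) ht
  refine IsDist.mk_of (hP.paste_horiz hR) (s ≫ t') ?_ ?_ (W.weq_comp _ _ hs ht')
  · simp [s, hl']
  · simp [s, hr', reassoc_of% hr]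

variable (W)

/-- The category of cofibrations. -/
@[reducible]
def cofCategory : Category.{v} C where
  Hom A B := { f : A ⟶ B // W.cof f }
  id A := ⟨𝟙 A, W.cof_of_isIso _⟩
  comp f g := ⟨f.1 ≫ g.1, W.cof_comp _ _ f.2 g.2⟩

/-- The squares category associated with a Waldhausen category: horizontal morphisms are the
cofibrations, vertical morphisms are all morphisms. -/
def squaresCategory : SquaresCategory.{v} C where
  hor := W.cofCategory
  ver := inferInstance
  IsDist f f' g g' := W.IsDist f.1 f'.1 g g'
  dist_vcomp {_ _ _ _ _ _ f f' _ _ _ _ _} H H' := H.vcomp f.2 f'.2 H'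
  dist_hcomp {_ _ _ _ _ _ f h _ _ _ _ _} H H' := H.hcomp f.2 h.2 H'
  dist_ver_id f := IsDist.mk_of (IsPushout.of_vert_isIso ⟨by simp⟩ : IsPushout f.1 (𝟙 _) (𝟙 _) f.1)
    (𝟙 _) (by simp) (by simp) (W.weq_of_isIso _)
  dist_hor_id g := IsDist.mk_of (IsPushout.of_horiz_isIso ⟨by simp⟩ : IsPushout (𝟙 _) g g (𝟙 _))
    (𝟙 _) (by simp) (Category.comp_id (𝟙 _)) (W.weq_of_isIso _)
  base := W.zero
  base_hor_initial := ⟨@Limits.IsInitial.ofUniqueHom C W.cofCategory W.zero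
    (fun A => ⟨W.isZero_zero.to_ A, W.cof_from_zero _⟩)
    (fun _ _ => Subtype.ext (W.isZero_zero.eq_of_src _ _))⟩
  base_ver_initial := ⟨W.isZero_zero.isInitial⟩

/-! #### The `S_•`-construction and Waldhausen K-theory -/

/-- The objects of `S_n C`: diagrams `A : Ar[n] ⥤ C` with `A_{j,j}` the zero object, such that for
`i ≤ j ≤ k` the map `A_{i,j} ⟶ A_{i,k}` is a cofibration and the square with corners
`A_{i,j}`, `A_{i,k}`, `A_{j,j}`, `A_{j,k}` is a pushout. -/
structure SObj (n : ℕ) where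
  functor : Arrow (Fin (n + 1)) ⥤ C
  obj_diag : ∀ j : Fin (n + 1), functor.obj (Arrow.mk (𝟙 j)) = W.zero
  cof_map : ∀ {i j k : Fin (n + 1)} (f : i ⟶ j) (g : j ⟶ k),
    W.cof (functor.map (Arrow.homMk (𝟙 i) g : Arrow.mk f ⟶ Arrow.mk (f ≫ g)))
  isPushout : ∀ {i j k : Fin (n + 1)} (f : i ⟶ j) (g : j ⟶ k),
    IsPushout (functor.map (Arrow.homMk (𝟙 i) g : Arrow.mk f ⟶ Arrow.mk (f ≫ g)))
      (functor.map (Arrow.homMk f (𝟙 j) : Arrow.mk f ⟶ Arrow.mk (𝟙 j)))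
      (functor.map (Arrow.homMk f (𝟙 k) : Arrow.mk (f ≫ g) ⟶ Arrow.mk g))
      (functor.map (Arrow.homMk (𝟙 j) g : Arrow.mk (𝟙 j) ⟶ Arrow.mk g))

variable {W}

/-- The morphisms of `wS_n C`: natural transformations all of whose components are weak
equivalences. -/
@[ext]
structure SObj.Hom {n : ℕ} (A B : W.SObj n) where
  natTrans : A.functor ⟶ B.functor
  weq : ∀ x, W.weq (natTrans.app x)

/-- The category `wS_n C`. -/
instance (n : ℕ) : Category.{v} (W.SObj n) where
  Hom A B := SObj.Hom A B
  id A := ⟨𝟙 _, fun _ => W.weq_of_isIso _⟩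
  comp α β := ⟨α.natTrans ≫ β.natTrans, fun x => W.weq_comp _ _ (α.weq x) (β.weq x)⟩

/-- The functor `wS_n C ⥤ wS_m C` induced by a monotone map `[m] ⟶ [n]`. -/
def SObj.precomp {m n : ℕ} (θ : Fin (m + 1) →o Fin (n + 1)) : W.SObj n ⥤ W.SObj m where
  obj A :=
    { functor := θ.monotone.functor.mapArrow ⋙ A.functor
      obj_diag := fun j => A.obj_diag (θ j)
      cof_map := fun f g => A.cof_map (θ.monotone.functor.map f) (θ.monotone.functor.map g)
      isPushout := fun f g =>
        A.isPushout (θ.monotone.functor.map f) (θ.monotone.functor.map g) }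
  map α := ⟨Functor.whiskerLeft _ α.natTrans, fun _ => α.weq _⟩

variable (W)

/-- The simplicial category `wS_• C`. -/
def wS : SimplexCategoryᵒᵖ ⥤ Cat.{v, max u v} where
  obj n := Cat.of (W.SObj n.unop.len)
  map θ := (SObj.precomp θ.unop.toOrderHom).toCatHom
  map_id _ := rfl
  map_comp _ _ := rfl

/-- The (only) object of `wS_0 C`, the diagram with value the zero object. -/
def baseS₀ : W.wS.obj (op ⦋0⦌) :=
  SObj.mk (W := W) (n := 0) ((Functor.const (Arrow (Fin 1))).obj W.zero) (fun _ => rfl)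
    (fun _ _ => W.cof_of_isIso (𝟙 W.zero)) (fun _ _ => IsPushout.of_id_fst)

/-- The base point of `|wS_• C|`. -/
noncomputable def basePoint : SimplicialCat.realization W.wS := SimplicialCat.point W.wS W.baseS₀

/-- The Waldhausen K-theory space `Ω|wS_• C|`, with the compact-open topology. -/
abbrev K : Type (max u v) := LoopSpace (SimplicialCat.realization W.wS) W.basePoint

end WaldhausenCategory

/-!
Sending a flag `F` in `T_n C'` to the diagram of its quotients `F j / F i` defines a map
`T_• C' ⟶ wS_• C`. For a map back, pass to the edgewise subdivision, whose `n`-simplices are indexed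
by the join `[n] * [n]`. A diagram `A` indexed by the arrows of `[n] * [n]` restricts to the grid
`A_{l, r}`, with `l` in the first and `r` in the second half. Its rows consist of cofibrations, and
its vertical maps are part of pushout squares; composed with weak equivalences `A ⟶ A'` they still
form distinguished squares, so that a chain of diagrams gives a simplex of `T_• C'`.

Both composites are related by natural transformations to the restriction to the second half: the
quotient of `A_{l, r} ⟶ A_{l, r'}` is `A_{r, r'}`, and the projections `F r ⟶ F r / F l` form
pushout squares. The restriction to the second half is homotopic to the homeomorphism
`|X| ≅ |sd X|`, by moving the weights of a point of a simplex from one half to the other. All these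
homotopies fix the base point and hence pass to loop spaces.
-/

/-! ### Points of simplices as probability measures -/

namespace SimplexMeasure

open stdSimplex

section Pushforward

variable {X Y : Type*} [Fintype X] [Fintype Y]

lemma map_apply_eq_sum [DecidableEq Y] (f : X → Y) (s : stdSimplex ℝ X) (y : Y) :
    map f s y = ∑ x with f x = y, s x := by
  rw [map_coe, FunOnFinite.linearMap_apply_apply]

lemma sum_map_filter (f : X → Y) (s : stdSimplex ℝ X) (P : Y → Prop) [DecidablePred P] :
    ∑ y with P y, map f s y = ∑ x with P (f x), s x := by
  classical
  simp_rw [map_apply_eq_sum]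
  simpa using Finset.sum_fiberwise_eq_sum_filter Finset.univ {y | P y} f s

lemma le_map_apply (f : X → Y) (s : stdSimplex ℝ X) (x : X) : s x ≤ map f s (f x) := by
  classical
  rw [map_apply_eq_sum]
  exact Finset.single_le_sum (f := s) (fun x _ => stdSimplex.zero_le s x) (by simp)

end Pushforward

section Uniqueness

variable {J L : Type*} [Fintype J] [LinearOrder J] [Fintype L] [LinearOrder L] {f g : J → L}
  {z : stdSimplex ℝ J}

lemma le_of_map_eq_map (hf : Monotone f) (hg : Monotone g) (hz : ∀ j, 0 < z j)
    (h : map f z = map g z) (k : J) : g k ≤ f k := by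
  by_contra! hk
  have heq : ∑ j with f j ≤ f k, z j = ∑ j with g j ≤ f k, z j := by
    rw [← sum_map_filter f z (· ≤ f k), h, sum_map_filter g z (· ≤ f k)]
  have hsub : (Finset.univ.filter fun j => g j ≤ f k) ⊆ Finset.univ.filter fun j => f j ≤ f k := by
    intro j hj
    simp only [Finset.mem_filter, Finset.mem_univ, true_and] at hj ⊢
    exact hf (hg.reflect_lt (hj.trans_lt hk)).le
  exact (Finset.sum_lt_sum_of_subset hsub (i := k) (by simp) (by simpa using hk) (hz k)
    fun j _ _ => (hz j).le).ne' heq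

lemma eq_of_map_eq_map (hf : Monotone f) (hg : Monotone g) (hz : ∀ j, 0 < z j)
    (h : map f z = map g z) : f = g :=
  funext fun k => le_antisymm (le_of_map_eq_map hg hf hz h.symm k) (le_of_map_eq_map hf hg hz h k)

end Uniqueness

section Support

variable {L : Type*} [Fintype L] [LinearOrder L]

lemma exists_pos_map_eq (w : stdSimplex ℝ L) :
    ∃ (m : ℕ) (e : Fin (m + 1) →o L) (z : stdSimplex ℝ (Fin (m + 1))),
      (∀ i, 0 < z i) ∧ map e z = w := by
  classical
  let S : Finset L := {x | w x ≠ 0}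
  have hS : ∑ x ∈ S, w x = 1 := by rw [Finset.sum_filter_ne_zero, stdSimplex.sum_eq_one]
  obtain ⟨m, hm⟩ : ∃ m, S.card = m + 1 :=
    Nat.exists_eq_succ_of_ne_zero fun h => by simp [Finset.card_eq_zero.1 h] at hS
  let e := S.orderEmbOfFin hm
  have he : Finset.univ.map e.toEmbedding = S := S.map_orderEmbOfFin_univ hm
  have hpos (i : Fin (m + 1)) : 0 < w (e i) :=
    (stdSimplex.zero_le w _).lt_of_ne' (Finset.mem_filter.1 (S.orderEmbOfFin_mem hm i)).2
  refine ⟨m, e.toOrderHom, ⟨fun i => w (e i), fun i => (hpos i).le, ?_⟩, hpos, ?_⟩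
  · rw [← hS, ← he, Finset.sum_map]
    rfl
  · ext x
    rw [map_apply_eq_sum]
    change ∑ i with e i = x, w (e i) = w x
    calc ∑ i with e i = x, w (e i) = ∑ y ∈ S with y = x, w y := by
          rw [← he, Finset.filter_map, Finset.sum_map]
          rfl
      _ = w x := by
          rw [Finset.filter_eq']
          by_cases hx : w x = 0 <;> simp [S, hx]

end Support

section Coupling

variable {p q : ℕ}

/-- The mass of the points before `i`. The intervals `[cumul s i, cumul s (i + 1)]` partition the
unit interval into pieces of length `s i`. -/
noncomputable def cumul (s : stdSimplex ℝ (Fin p)) (i : ℕ) : ℝ :=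
  ∑ k with k.val < i, s k

lemma cumul_zero (s : stdSimplex ℝ (Fin p)) : cumul s 0 = 0 := by simp [cumul]

lemma cumul_last (s : stdSimplex ℝ (Fin p)) : cumul s p = 1 := by
  rw [cumul, Finset.filter_true_of_mem fun k _ => k.isLt, stdSimplex.sum_eq_one]

lemma cumul_mono (s : stdSimplex ℝ (Fin p)) : Monotone (cumul s) := fun _ _ hij =>
  Finset.sum_le_sum_of_subset_of_nonneg (Finset.monotone_filter_right _ fun _ _ h => h.trans_le hij)
    fun k _ _ => stdSimplex.zero_le s k

lemma cumul_succ (s : stdSimplex ℝ (Fin p)) (i : Fin p) :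
    cumul s (i + 1) = cumul s i + s i := by
  have h : (Finset.univ.filter fun k : Fin p => k.val < i + 1) =
      insert i (Finset.univ.filter fun k : Fin p => k.val < i) := by
    ext k
    simp only [Finset.mem_filter, Finset.mem_univ, true_and, Finset.mem_insert, Fin.ext_iff]
    omega
  rw [cumul, h, Finset.sum_insert (by simp), add_comm]
  rfl

/-- The length of the intersection of the `i`-th interval of `s` and the `j`-th interval
of `s'`. -/
noncomputable def overlap (s : stdSimplex ℝ (Fin p)) (s' : stdSimplex ℝ (Fin q)) (i j : ℕ) : ℝ :=
  max 0 (min (cumul s (i + 1)) (cumul s' (j + 1)) - max (cumul s i) (cumul s' j))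

variable (s : stdSimplex ℝ (Fin p)) (s' : stdSimplex ℝ (Fin q))

lemma overlap_symm (i j : ℕ) : overlap s s' i j = overlap s' s j i := by
  rw [overlap, overlap, min_comm, max_comm (cumul s i)]

lemma overlap_eq_sub (i j : ℕ) : overlap s s' i j =
    min (max (cumul s' (j + 1)) (cumul s i)) (cumul s (i + 1)) -
      min (max (cumul s' j) (cumul s i)) (cumul s (i + 1)) := by
  have h := cumul_mono s i.le_succ
  have h' := cumul_mono s' j.le_succ
  grind [overlap]

lemma sum_overlap (i : Fin p) : ∑ j : Fin q, overlap s s' i j = s i := by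
  simp_rw [Fin.sum_univ_eq_sum_range (fun j => overlap s s' i j), overlap_eq_sub]
  rw [Finset.sum_range_sub (fun j => min (max (cumul s' j) (cumul s i)) (cumul s (i + 1))),
    cumul_last, cumul_zero]
  have h0 := cumul_zero s ▸ cumul_mono s (Nat.zero_le i)
  have h1 := cumul_last s ▸ cumul_mono s (Nat.succ_le_of_lt i.isLt)
  have h2 := cumul_mono s (i : ℕ).le_succ
  have h3 := cumul_succ s i
  grind

lemma le_of_overlap_pos {i i' j j' : ℕ} (h : 0 < overlap s s' i j) (h' : 0 < overlap s s' i' j')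
    (hi : i < i') : j ≤ j' := by
  by_contra! hj
  have hcumul := cumul_mono s (Nat.succ_le_of_lt hi)
  have hcumul' := cumul_mono s' (Nat.succ_le_of_lt hj)
  simp only [overlap, lt_max_iff, lt_irrefl, false_or, sub_pos, lt_min_iff, max_lt_iff] at h h'
  linarith [h.1.2, h'.2.1]

/-- The measure on the product with marginals `s` and `s'` whose support is a chain. -/
noncomputable def coupling : stdSimplex ℝ (Fin p × Fin q) :=
  ⟨fun x => overlap s s' x.1 x.2, fun _ => le_max_left _ _, by
    rw [Fintype.sum_prod_type]
    simp_rw [sum_overlap, stdSimplex.sum_eq_one]⟩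

lemma coupling_apply (x : Fin p × Fin q) : coupling s s' x = overlap s s' x.1 x.2 := rfl

lemma map_fst_coupling : map Prod.fst (coupling s s') = s := by
  ext i
  simp [map_apply_eq_sum, coupling_apply, Finset.sum_filter, Fintype.sum_prod_type_right,
    sum_overlap]

lemma map_snd_coupling : map Prod.snd (coupling s s') = s' := by
  ext j
  simp [map_apply_eq_sum, coupling_apply, Finset.sum_filter, Fintype.sum_prod_type,
    overlap_symm s s', sum_overlap]

lemma exists_monotone_map_eq_map_eq :
    ∃ (m : ℕ) (f : Fin (m + 1) →o Fin p) (g : Fin (m + 1) →o Fin q)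
      (z : stdSimplex ℝ (Fin (m + 1))), (∀ i, 0 < z i) ∧ map f z = s ∧ map g z = s' := by
  obtain ⟨m, e, z, hz, he⟩ := exists_pos_map_eq (map toLex (coupling s s'))
  have hmap : map (fun k => ofLex (e k)) z = coupling s s' := by
    have h := congrArg (map ofLex) he
    rw [map_comp_apply, map_comp_apply] at h
    exact h.trans (map_id_apply _)
  have hpos (k) : 0 < coupling s s' (ofLex (e k)) :=
    (hz k).trans_le (hmap ▸ le_map_apply (fun k => ofLex (e k)) z k)
  have hfst : Monotone fun k => (ofLex (e k)).1 := fun k l hkl => by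
    rcases Prod.Lex.le_iff.1 (e.monotone hkl) with h | h
    exacts [h.le, h.1.le]
  have hsnd : Monotone fun k => (ofLex (e k)).2 := fun k l hkl => by
    rcases Prod.Lex.le_iff.1 (e.monotone hkl) with h | h
    exacts [le_of_overlap_pos s s' (hpos k) (hpos l) h, h.2]
  refine ⟨m, ⟨_, hfst⟩, ⟨_, hsnd⟩, z, hz, ?_, ?_⟩
  · rw [← map_fst_coupling s s', ← hmap, map_comp_apply]
    rfl
  · rw [← map_snd_coupling s s', ← hmap, map_comp_apply]
    rfl

end Coupling

section ConvexCombination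

variable {X Y : Type*} [Fintype X] [Fintype Y]

/-- The point `(1 - a) x + a y`. -/
noncomputable def convexComb (a : unitInterval) (x y : stdSimplex ℝ X) : stdSimplex ℝ X :=
  ⟨(1 - (a : ℝ)) • x.1 + (a : ℝ) • y.1,
    convex_stdSimplex ℝ X x.2 y.2 (sub_nonneg.2 a.2.2) a.2.1 (by ring)⟩

lemma convexComb_apply (a : unitInterval) (x y : stdSimplex ℝ X) (i : X) :
    convexComb a x y i = (1 - (a : ℝ)) * x i + a * y i := rfl

lemma map_convexComb (f : X → Y) (a : unitInterval) (x y : stdSimplex ℝ X) :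
    map f (convexComb a x y) = convexComb a (map f x) (map f y) := by
  classical
  ext j
  simp only [convexComb_apply, map_apply_eq_sum, Finset.mul_sum, ← Finset.sum_add_distrib]

lemma convexComb_zero (x y : stdSimplex ℝ X) : convexComb 0 x y = x := by
  ext i
  simp [convexComb_apply]

lemma convexComb_one (x y : stdSimplex ℝ X) : convexComb 1 x y = y := by
  ext i
  simp [convexComb_apply]

lemma continuous_convexComb :
    Continuous fun q : unitInterval × stdSimplex ℝ X × stdSimplex ℝ X =>
      convexComb q.1 q.2.1 q.2.2 :=
  Continuous.subtype_mk (by fun_prop) _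

end ConvexCombination

end SimplexMeasure

/-! ### Geometric realizations, cell by cell -/

namespace Realization

/-- The topological simplex with vertices `[n]`. -/
abbrev TopSimplex (n : SimplexCategory) : Type := stdSimplex ℝ (Fin (n.len + 1))

variable {X Y : SSet.{u}}

/-- The characteristic map of a (possibly degenerate) simplex `x` of `X`. -/
noncomputable def cell {n : SimplexCategory} (x : X.obj (op n)) :
    C(TopSimplex n, SSet.toTop.obj X) :=
  TopCat.toSSetObjEquiv _ _ ((sSetTopAdj.unit.app X).app (op n) x)

lemma cell_map {m n : SimplexCategory} (θ : m ⟶ n) (x : X.obj (op n)) (t : TopSimplex m) :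
    cell (X.map θ.op x) t = cell x (stdSimplex.map θ t) := by
  have hnat := ConcreteCategory.congr_hom ((sSetTopAdj.unit.app X).naturality θ.op) x
  exact DFunLike.congr_fun (congrArg (TopCat.toSSetObjEquiv _ (op m)) hnat) t

/-- The continuous map `|f|`. -/
noncomputable def map (f : X ⟶ Y) : C(SSet.toTop.obj X, SSet.toTop.obj Y) :=
  (SSet.toTop.map f).hom

lemma map_cell (f : X ⟶ Y) {n : SimplexCategory} (x : X.obj (op n)) (t : TopSimplex n) :
    map f (cell x t) = cell (f.app _ x) t := by
  have hnat := ConcreteCategory.congr_hom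
    (NatTrans.congr_app (sSetTopAdj.unit.naturality f) (op n)) x
  exact (DFunLike.congr_fun (congrArg (TopCat.toSSetObjEquiv _ (op n)) hnat) t).symm

lemma map_id (X : SSet.{u}) : map (𝟙 X) = ContinuousMap.id _ := by
  rw [map, SSet.toTop.map_id]
  rfl

lemma map_comp {Z : SSet.{u}} (f : X ⟶ Y) (g : Y ⟶ Z) : map (f ≫ g) = (map g).comp (map f) := by
  rw [map, SSet.toTop.map_comp]
  rfl

lemma vertexPoint_eq_cell (x : X.obj (op ⦋0⦌)) (t : TopSimplex ⦋0⦌) :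
    SSet.vertexPoint X x = cell x t := by
  have : Subsingleton (TopSimplex ⦋0⦌) := inferInstanceAs (Subsingleton (stdSimplex ℝ (Fin 1)))
  exact congrArg (cell x) (Subsingleton.elim _ t)

lemma map_vertexPoint (f : X ⟶ Y) (x : X.obj (op ⦋0⦌)) :
    map f (SSet.vertexPoint X x) = SSet.vertexPoint Y (f.app _ x) := by
  rw [vertexPoint_eq_cell x (stdSimplex.vertex 0), map_cell, ← vertexPoint_eq_cell]

lemma cell_degenerate (x : X.obj (op ⦋0⦌)) {n : SimplexCategory} (θ : n ⟶ ⦋0⦌)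
    (t : TopSimplex n) : cell (X.map θ.op x) t = SSet.vertexPoint X x := by
  rw [cell_map, ← vertexPoint_eq_cell]

/-- A family of continuous maps on the simplices of `X` that is compatible with faces and
degeneracies. Such families correspond to continuous maps out of `|X|`. -/
structure CellFamily (X : SSet.{u}) (Z : Type*) [TopologicalSpace Z] where
  toFun {n : SimplexCategory} (x : X.obj (op n)) : C(TopSimplex n, Z)
  toFun_map {m n : SimplexCategory} (θ : m ⟶ n) (x : X.obj (op n)) (t : TopSimplex m) :
    toFun (X.map θ.op x) t = toFun x (stdSimplex.map θ t)

namespace CellFamily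

/-- The map into the singular simplicial set of `Z` that is adjoint to `F.lift`. -/
noncomputable def toSingular {Z : Type u} [TopologicalSpace Z] (F : CellFamily X Z) :
    X ⟶ TopCat.toSSet.obj (TopCat.of Z) where
  app n := TypeCat.ofHom fun x => (TopCat.toSSetObjEquiv (TopCat.of Z) n).symm (F.toFun x)
  naturality m n θ := by
    ext x
    apply (TopCat.toSSetObjEquiv (TopCat.of Z) n).injective
    ext t
    exact F.toFun_map θ.unop x t

/-- The continuous map on `|X|` that restricts to the given maps on simplices. -/
noncomputable def lift {Z : Type u} [TopologicalSpace Z] (F : CellFamily X Z) :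
    C(SSet.toTop.obj X, Z) :=
  ((sSetTopAdj.homEquiv X (TopCat.of Z)).symm F.toSingular).hom

lemma lift_cell {Z : Type u} [TopologicalSpace Z] (F : CellFamily X Z) {n : SimplexCategory}
    (x : X.obj (op n)) (t : TopSimplex n) : F.lift (cell x t) = F.toFun x t := by
  have hadj := (sSetTopAdj.homEquiv X (TopCat.of Z)).apply_symm_apply F.toSingular
  rw [Adjunction.homEquiv_unit] at hadj
  have hx := ConcreteCategory.congr_hom (NatTrans.congr_app hadj (op n)) x
  exact DFunLike.congr_fun (congrArg (TopCat.toSSetObjEquiv (TopCat.of Z) (op n)) hx) t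

end CellFamily

/- Maps out of `|X|` are determined by the cells, so the indicator of the union of all cells, viewed
as a map into an indiscrete space, is constant. -/
lemma exists_cell_eq (a : SSet.toTop.obj X) :
    ∃ (n : SimplexCategory) (x : X.obj (op n)) (t : TopSimplex n), cell x t = a := by
  let : TopologicalSpace (ULift.{u} Prop) := ⊤
  let IsOnCell : SSet.toTop.obj X → ULift.{u} Prop :=
    fun a => ⟨∃ (n : SimplexCategory) (x : X.obj (op n)) (t : TopSimplex n), cell x t = a⟩
  let f : SSet.toTop.obj X ⟶ TopCat.of (ULift.{u} Prop) := TopCat.ofHom ⟨IsOnCell, continuous_top⟩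
  let g : SSet.toTop.obj X ⟶ TopCat.of (ULift.{u} Prop) :=
    TopCat.ofHom ⟨fun _ => ⟨True⟩, continuous_top⟩
  have hfg : f = g := by
    apply (sSetTopAdj.homEquiv X _).injective
    rw [Adjunction.homEquiv_unit, Adjunction.homEquiv_unit]
    ext n x
    apply (TopCat.toSSetObjEquiv _ n).injective
    ext t : 1
    exact congrArg ULift.up (eq_true ⟨_, x, t, rfl⟩)
  exact of_eq_true (congrArg ULift.down (ConcreteCategory.congr_hom hfg a))

instance [X.Finite] : CompactSpace (SSet.toTop.obj X) := by
  have hcover : ⋃ x : X.N, Set.range (cell x.simplex) = Set.univ := by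
    refine Set.eq_univ_of_forall fun a => ?_
    obtain ⟨n, x, t, rfl⟩ := exists_cell_eq a
    induction n using SimplexCategory.rec with | _ n
    obtain ⟨m, f, _, y, rfl⟩ := X.exists_nonDegenerate x
    exact Set.mem_iUnion.2 ⟨SSet.N.mk _ y.2, stdSimplex.map f t, (cell_map f _ t).symm⟩
  refine ⟨?_⟩
  rw [← hcover]
  exact isCompact_iUnion fun x => isCompact_range (cell x.simplex).continuous

lemma CellFamily.exists_inverse [X.Finite] {Z : Type} [TopologicalSpace Z] [T2Space Z]
    (F : CellFamily X Z)
    (hsurj : ∀ a : Z, ∃ (n : SimplexCategory) (x : X.obj (op n)) (t : TopSimplex n),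
      F.toFun x t = a)
    (hinj : ∀ {m n : SimplexCategory} (x : X.obj (op m)) (y : X.obj (op n)) (t : TopSimplex m)
      (t' : TopSimplex n), F.toFun x t = F.toFun y t' → cell x t = cell y t') :
    ∃ G : C(Z, SSet.toTop.obj X), ∀ {n : SimplexCategory} (x : X.obj (op n)) (t : TopSimplex n),
      G (F.toFun x t) = cell x t := by
  let F' : CellFamily X (ULift.{u} Z) :=
    { toFun := fun x => ⟨fun t => ⟨F.toFun x t⟩, by fun_prop⟩
      toFun_map := fun θ x t => congrArg ULift.up (F.toFun_map θ x t) }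
  have hcell {n : SimplexCategory} (x : X.obj (op n)) (t) : F'.lift (cell x t) = ⟨F.toFun x t⟩ :=
    F'.lift_cell x t
  have hbij : Function.Bijective F'.lift := by
    constructor
    · intro a b hab
      obtain ⟨m, x, t, rfl⟩ := exists_cell_eq a
      obtain ⟨n, y, t', rfl⟩ := exists_cell_eq b
      rw [hcell, hcell] at hab
      exact hinj x y t t' (ULift.up_injective hab)
    · rintro ⟨a⟩
      obtain ⟨n, x, t, rfl⟩ := hsurj a
      exact ⟨_, hcell x t⟩
  let e := F'.lift.continuous.homeoOfEquivCompactToT2 (f := Equiv.ofBijective _ hbij)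
  refine ⟨⟨fun a => e.symm ⟨a⟩, by fun_prop⟩, fun x t => ?_⟩
  rw [ContinuousMap.coe_mk, Homeomorph.symm_apply_eq]
  exact (hcell x t).symm

end Realization

/-! ### The edgewise subdivision -/

namespace EdgewiseSubdivision

open Realization SimplexMeasure

section Double

/-- The ordinal `[n] * [n]`. -/
def double (n : SimplexCategory) : SimplexCategory := ⦋n.len + 1 + n.len⦌

/-- The inclusion of the first half of `[n] * [n]`. -/
def inl (n : SimplexCategory) : n ⟶ double n :=
  SimplexCategory.Hom.mk ⟨fun i => Fin.castAdd (n.len + 1) i, fun _ _ h => h⟩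

/-- The inclusion of the second half of `[n] * [n]`. -/
def inr (n : SimplexCategory) : n ⟶ double n :=
  SimplexCategory.Hom.mk ⟨fun i => Fin.natAdd (n.len + 1) i, fun _ _ h => Nat.add_le_add_left h _⟩

@[elab_as_elim]
lemma double_cases {n : SimplexCategory} {P : Fin ((double n).len + 1) → Prop}
    (inl : ∀ i, P (inl n i)) (inr : ∀ i, P (inr n i)) (i) : P i :=
  Fin.addCases (m := n.len + 1) (n := n.len + 1) (motive := P) inl inr i

lemma inl_lt_inr {n : SimplexCategory} (i j : Fin (n.len + 1)) : inl n i < inr n j :=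
  Nat.lt_add_right _ i.isLt

variable {m n k : SimplexCategory}

/-- The underlying function of `copair f g`. -/
def copairFun (f g : m ⟶ n) (i : Fin ((double m).len + 1)) : Fin (n.len + 1) :=
  Fin.addCases (m := m.len + 1) (n := m.len + 1) (motive := fun _ => Fin (n.len + 1)) f g i

lemma copairFun_inl (f g : m ⟶ n) (i : Fin (m.len + 1)) : copairFun f g (inl m i) = f i :=
  Fin.addCases_left (motive := fun _ => Fin (n.len + 1)) i

lemma copairFun_inr (f g : m ⟶ n) (i : Fin (m.len + 1)) : copairFun f g (inr m i) = g i :=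
  Fin.addCases_right (motive := fun _ => Fin (n.len + 1)) i

/-- The map out of `[m] * [m]` with restrictions `f ≤ g` to the two halves. -/
def copair (f g : m ⟶ n) (h : ∀ i j, f i ≤ g j) : double m ⟶ n :=
  SimplexCategory.Hom.mk ⟨copairFun f g, by
    intro i j hij
    induction i using double_cases with
    | inl i =>
      induction j using double_cases with
      | inl j =>
        simp only [copairFun_inl]
        exact f.toOrderHom.monotone hij
      | inr j => simpa only [copairFun_inl, copairFun_inr] using h i j
    | inr i =>
      induction j using double_cases with
      | inl j => exact absurd hij (inl_lt_inr j i).not_ge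
      | inr j =>
        simp only [copairFun_inr]
        exact g.toOrderHom.monotone (Nat.le_of_add_le_add_left hij)⟩

@[simp]
lemma inl_copair (f g : m ⟶ n) (h) : inl m ≫ copair f g h = f := by
  ext i : 3
  exact copairFun_inl f g i

@[simp]
lemma inr_copair (f g : m ⟶ n) (h) : inr m ≫ copair f g h = g := by
  ext i : 3
  exact copairFun_inr f g i

lemma double_hom_ext {f g : double m ⟶ n} (hl : inl m ≫ f = inl m ≫ g)
    (hr : inr m ≫ f = inr m ≫ g) : f = g := by
  ext i : 3
  exact double_cases (P := fun i => f i = g i) (fun i => ConcreteCategory.congr_hom hl i)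
    (fun i => ConcreteCategory.congr_hom hr i) i

/-- The map `θ * θ`. -/
def doubleMap (θ : m ⟶ n) : double m ⟶ double n :=
  copair (θ ≫ inl _) (θ ≫ inr _) fun i j => (inl_lt_inr (θ i) (θ j)).le

lemma inl_doubleMap (θ : m ⟶ n) : inl m ≫ doubleMap θ = θ ≫ inl n := inl_copair _ _ _

lemma inr_doubleMap (θ : m ⟶ n) : inr m ≫ doubleMap θ = θ ≫ inr n := inr_copair _ _ _

/-- The functor `[n] ↦ [n] * [n]`. -/
def doubleFunctor : SimplexCategory ⥤ SimplexCategory where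
  obj := double
  map := doubleMap
  map_id n := double_hom_ext (by simp [inl_doubleMap]) (by simp [inr_doubleMap])
  map_comp f g := double_hom_ext
    (by rw [← Category.assoc, inl_doubleMap f, Category.assoc, inl_doubleMap g,
      inl_doubleMap, Category.assoc])
    (by rw [← Category.assoc, inr_doubleMap f, Category.assoc, inr_doubleMap g,
      inr_doubleMap, Category.assoc])

end Double

section Spread

variable {m n k : SimplexCategory}

lemma map_map (f : m ⟶ n) (g : n ⟶ k) (t : TopSimplex m) :
    stdSimplex.map g (stdSimplex.map f t) = stdSimplex.map (f ≫ g) t :=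
  stdSimplex.map_comp_apply _ _ _

/-- The point of the simplex on `[n] * [n]` with weight `1 - a` on the first copy of `t` and
weight `a` on the second one. -/
noncomputable def spread (a : unitInterval) (t : TopSimplex n) : TopSimplex (double n) :=
  convexComb a (stdSimplex.map (inl n) t) (stdSimplex.map (inr n) t)

lemma map_spread (y : double m ⟶ n) (a : unitInterval) (t : TopSimplex m) :
    stdSimplex.map y (spread a t) =
      convexComb a (stdSimplex.map (inl m ≫ y) t) (stdSimplex.map (inr m ≫ y) t) := by
  rw [spread, map_convexComb, map_map, map_map]

lemma spread_map (θ : m ⟶ n) (a : unitInterval) (t : TopSimplex m) :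
    spread a (stdSimplex.map θ t) = stdSimplex.map (doubleMap θ) (spread a t) := by
  rw [map_spread, inl_doubleMap, inr_doubleMap, spread, map_map, map_map]

lemma spread_zero (t : TopSimplex n) : spread 0 t = stdSimplex.map (inl n) t :=
  convexComb_zero _ _

lemma spread_one (t : TopSimplex n) : spread 1 t = stdSimplex.map (inr n) t :=
  convexComb_one _ _

lemma continuous_spread :
    Continuous fun q : unitInterval × TopSimplex n => spread q.1 q.2 :=
  continuous_convexComb.comp (continuous_fst.prodMk
    (((stdSimplex.continuous_map _).comp continuous_snd).prodMk
      ((stdSimplex.continuous_map _).comp continuous_snd)))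

/-- The midpoint of the unit interval. -/
noncomputable def mid : unitInterval := ⟨1 / 2, by norm_num, by norm_num⟩

lemma convexComb_mid_apply {X : Type*} [Fintype X] (x y : stdSimplex ℝ X) (i : X) :
    convexComb mid x y i = (x i + y i) / 2 := by
  rw [convexComb_apply]
  change (1 - 1 / 2 : ℝ) * x i + 1 / 2 * y i = _
  ring

lemma spread_mid_pos {t : TopSimplex n} (ht : ∀ i, 0 < t i) (i) : 0 < spread mid t i := by
  have hnonneg (f : n ⟶ double n) := stdSimplex.zero_le (stdSimplex.map f t) i
  rw [spread, convexComb_mid_apply]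
  induction i using double_cases with
  | inl i =>
    have hle := le_map_apply (inl n) t i
    linarith [ht i, hnonneg (inr n)]
  | inr i =>
    have hle := le_map_apply (inr n) t i
    linarith [ht i, hnonneg (inl n)]

lemma exists_hom_map_eq_map_eq (s : TopSimplex m) (s' : TopSimplex n) :
    ∃ (k : SimplexCategory) (f : k ⟶ m) (g : k ⟶ n) (z : TopSimplex k),
      (∀ i, 0 < z i) ∧ stdSimplex.map f z = s ∧ stdSimplex.map g z = s' := by
  obtain ⟨k, f, g, z, hz, hf, hg⟩ := exists_monotone_map_eq_map_eq s s'
  exact ⟨⦋k⦌, SimplexCategory.Hom.mk f, SimplexCategory.Hom.mk g, z, hz, hf, hg⟩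

lemma hom_eq_of_map_eq_map {f g : m ⟶ n} {z : TopSimplex m} (hz : ∀ i, 0 < z i)
    (h : stdSimplex.map f z = stdSimplex.map g z) : f = g := by
  ext i : 3
  exact congrFun (eq_of_map_eq_map f.toOrderHom.monotone g.toOrderHom.monotone hz h) i

/-- Twice the part of the measure `t` below (`j = 0`) or above (`j = 1`) its median, encoded through
the ordered coupling of `t` with the uniform measure on two points. -/
noncomputable def halfMeasure (t : TopSimplex n) (j : Fin 2) : TopSimplex n :=
  ⟨fun i => 2 * coupling t stdSimplex.barycenter (i, j),
    fun i => mul_nonneg zero_le_two (stdSimplex.zero_le _ _), by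
      have hj : (stdSimplex.barycenter : stdSimplex ℝ (Fin 2)) j = 2⁻¹ := by
        change (Fintype.card (Fin 2) : ℝ)⁻¹ = _
        simp
      have hsum := DFunLike.congr_fun (map_snd_coupling t (stdSimplex.barycenter (X := Fin 2))) j
      rw [hj, map_apply_eq_sum, Finset.sum_filter, Fintype.sum_prod_type] at hsum
      simp only [Finset.sum_ite_eq', Finset.mem_univ, if_true] at hsum
      rw [← Finset.mul_sum, hsum, mul_inv_cancel₀ two_ne_zero]⟩

lemma halfMeasure_apply (t : TopSimplex n) (j : Fin 2) (i : Fin (n.len + 1)) :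
    halfMeasure t j i = 2 * coupling t stdSimplex.barycenter (i, j) := rfl

lemma convexComb_halfMeasure (t : TopSimplex n) :
    convexComb mid (halfMeasure t 0) (halfMeasure t 1) = t := by
  ext i
  have hsum := sum_overlap t (stdSimplex.barycenter (X := Fin 2)) i
  rw [Fin.sum_univ_two] at hsum
  rw [convexComb_mid_apply, halfMeasure_apply, halfMeasure_apply, coupling_apply, coupling_apply]
  linarith

lemma le_of_halfMeasure_pos {t : TopSimplex n} {i j : Fin (n.len + 1)}
    (hi : 0 < halfMeasure t 0 i) (hj : 0 < halfMeasure t 1 j) : i ≤ j := by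
  by_contra! hlt
  rw [halfMeasure_apply, mul_pos_iff_of_pos_left two_pos] at hi hj
  exact absurd (le_of_overlap_pos t _ hj hi hlt : (1 : Fin 2) ≤ 0) (by decide)

lemma exists_map_spread_mid_eq (t : TopSimplex n) :
    ∃ (m : SimplexCategory) (y : double m ⟶ n) (z : TopSimplex m),
      stdSimplex.map y (spread mid z) = t := by
  obtain ⟨m, f, g, z, hz, hf, hg⟩ := exists_hom_map_eq_map_eq (halfMeasure t 0) (halfMeasure t 1)
  have hfg (i j) : f i ≤ g j := le_of_halfMeasure_pos
    ((hz i).trans_le (hf ▸ le_map_apply f z i)) ((hz j).trans_le (hg ▸ le_map_apply g z j))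
  refine ⟨m, copair f g hfg, z, ?_⟩
  rw [map_spread, inl_copair, inr_copair, hf, hg, convexComb_halfMeasure]

end Spread

open Realization SimplexMeasure

section SimplicialSet

/-- The edgewise subdivision of a simplicial set. -/
abbrev sd (X : SSet.{u}) : SSet.{u} := doubleFunctor.op ⋙ X

/-- The functoriality of the edgewise subdivision. -/
abbrev sdMap {X Y : SSet.{u}} (f : X ⟶ Y) : sd X ⟶ sd Y := Functor.whiskerLeft _ f

/-- The restriction of the simplices of the edgewise subdivision to their first halves. -/
def sdFirst (X : SSet.{u}) : sd X ⟶ X where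
  app n := X.map (inl n.unop).op
  naturality m n θ := by
    change X.map (doubleMap θ.unop).op ≫ X.map (inl n.unop).op =
      X.map (inl m.unop).op ≫ X.map θ.unop.op
    rw [← X.map_comp, ← X.map_comp, ← op_comp, ← op_comp, inl_doubleMap]

/-- The restriction of the simplices of the edgewise subdivision to their second halves. -/
def sdLast (X : SSet.{u}) : sd X ⟶ X where
  app n := X.map (inr n.unop).op
  naturality m n θ := by
    change X.map (doubleMap θ.unop).op ≫ X.map (inr n.unop).op =
      X.map (inr m.unop).op ≫ X.map θ.unop.op
    rw [← X.map_comp, ← X.map_comp, ← op_comp, ← op_comp, inr_doubleMap]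

instance finite_sd_stdSimplex (n : SimplexCategory) :
    SSet.Finite (sd (SSet.stdSimplex.{u}.obj n)) := by
  let ends := CartesianMonoidalCategory.lift (sdFirst (SSet.stdSimplex.{u}.obj n)) (sdLast _)
  have : Mono ends := by
    rw [NatTrans.mono_iff_mono_app]
    intro m
    rw [CategoryTheory.mono_iff_injective]
    intro y y' h
    have hl := congrArg (fun q => SSet.stdSimplex.objEquiv (Prod.fst q)) h
    have hr := congrArg (fun q => SSet.stdSimplex.objEquiv (Prod.snd q)) h
    exact SSet.stdSimplex.objEquiv.injective (double_hom_ext (m := m.unop) hl hr)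
  have : SSet.Finite (SSet.stdSimplex.{u}.obj n) := by
    induction n using SimplexCategory.rec with | _ n
    infer_instance
  exact SSet.finite_of_mono ends

variable {X Y : SSet.{u}}

/-- The vertex of the edgewise subdivision given by the degenerate edge at `x`. -/
def sdVertex (x : X.obj (op ⦋0⦌)) : (sd X).obj (op ⦋0⦌) :=
  X.map (SimplexCategory.const (double ⦋0⦌) ⦋0⦌ 0).op x

/-- The characteristic map of a simplex of the edgewise subdivision. -/
noncomputable def sdCell {n : SimplexCategory} (z : X.obj (op (double n))) :
    C(TopSimplex n, SSet.toTop.obj (sd X)) :=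
  cell (X := sd X) z

lemma map_sdMap_sdCell (f : X ⟶ Y) {n : SimplexCategory} (z : X.obj (op (double n)))
    (t : TopSimplex n) : map (sdMap f) (sdCell z t) = sdCell (f.app _ z) t :=
  map_cell (sdMap f) z t

lemma map_sdFirst_sdCell {n : SimplexCategory} (z : X.obj (op (double n))) (t : TopSimplex n) :
    map (sdFirst X) (sdCell z t) = cell (X.map (inl n).op z) t :=
  map_cell (sdFirst X) z t

lemma map_sdLast_sdCell {n : SimplexCategory} (z : X.obj (op (double n))) (t : TopSimplex n) :
    map (sdLast X) (sdCell z t) = cell (X.map (inr n).op z) t :=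
  map_cell (sdLast X) z t

lemma sdMap_comp_sdFirst (f : X ⟶ Y) : sdMap f ≫ sdFirst Y = sdFirst X ≫ f :=
  NatTrans.ext (funext fun n => (f.naturality (inl n.unop).op).symm)

lemma sdMap_comp_sdLast (f : X ⟶ Y) : sdMap f ≫ sdLast Y = sdLast X ≫ f :=
  NatTrans.ext (funext fun n => (f.naturality (inr n.unop).op).symm)

lemma app_sdVertex (f : X ⟶ Y) (x : X.obj (op ⦋0⦌)) :
    (sdMap f).app _ (sdVertex x) = sdVertex (f.app _ x) :=
  ConcreteCategory.congr_hom (f.naturality _) x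

lemma exists_cell_spread_eq (a : SSet.toTop.obj X) :
    ∃ (n : SimplexCategory) (z : X.obj (op (double n))) (t : TopSimplex n),
      cell z (spread mid t) = a := by
  obtain ⟨n, x, t, rfl⟩ := exists_cell_eq a
  obtain ⟨m, y, z, rfl⟩ := exists_map_spread_mid_eq t
  exact ⟨m, X.map y.op x, z, cell_map _ _ _⟩

lemma exists_sdCell_eq (a : SSet.toTop.obj (sd X)) :
    ∃ (n : SimplexCategory) (z : X.obj (op (double n))) (t : TopSimplex n), sdCell z t = a :=
  exists_cell_eq a

/-- The map from the edgewise subdivision given by a construction for all pairs of maps `l ≤ r` from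
`[n]` to the vertices of a simplex, by applying it to the two inclusions `[n] ⟶ [n] * [n]`. -/
def sdDesc (Φ : ∀ {n N : SimplexCategory} (_ : X.obj (op N)) (l r : n ⟶ N),
      (∀ i j, l i ≤ r j) → Y.obj (op n))
    (hX : ∀ {n N M : SimplexCategory} (x : X.obj (op M)) (τ : N ⟶ M) (l r : n ⟶ N)
      (h : ∀ i j, l i ≤ r j),
      Φ (X.map τ.op x) l r h =
        Φ x (l ≫ τ) (r ≫ τ) fun i j => τ.toOrderHom.monotone (h i j))
    (hY : ∀ {m n N : SimplexCategory} (x : X.obj (op N)) (θ : m ⟶ n) (l r : n ⟶ N)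
      (h : ∀ i j, l i ≤ r j),
      Y.map θ.op (Φ x l r h) = Φ x (θ ≫ l) (θ ≫ r) fun i j => h (θ i) (θ j)) :
    sd X ⟶ Y where
  app n := TypeCat.ofHom fun x =>
    Φ (N := double n.unop) x (inl n.unop) (inr n.unop) fun i j => (inl_lt_inr i j).le
  naturality m n θ := by
    ext x
    refine (hX x (doubleMap θ.unop) _ _ _).trans (Eq.trans ?_ (hY x θ.unop _ _ _).symm)
    congr 1
    · exact inl_doubleMap _
    · exact inr_doubleMap _

end SimplicialSet

section Subdivision

variable {X Y : SSet.{u}}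

lemma doubleMap_comp_eq {k l m n : SimplexCategory} {f : l ⟶ k} {g : l ⟶ m} {y : double k ⟶ n}
    {y' : double m ⟶ n} {z : TopSimplex l} (hz : ∀ i, 0 < z i)
    (h : stdSimplex.map y (spread mid (stdSimplex.map f z)) =
      stdSimplex.map y' (spread mid (stdSimplex.map g z))) :
    doubleMap f ≫ y = doubleMap g ≫ y' := by
  rw [spread_map, spread_map, map_map, map_map] at h
  exact hom_eq_of_map_eq_map (spread_mid_pos hz) h

/-- The simplices `t ↦ y (t / 2, t / 2)` into which edgewise subdivision cuts the topological
simplex. -/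
noncomputable def simplexPieces (n : SimplexCategory) :
    CellFamily (sd (SSet.stdSimplex.{u}.obj n)) (TopSimplex n) where
  toFun {m} y := ⟨fun t => stdSimplex.map (SSet.stdSimplex.objEquiv y) (spread (n := m) mid t),
    (stdSimplex.continuous_map _).comp
      (continuous_spread.comp (continuous_const.prodMk continuous_id))⟩
  toFun_map {k m} θ y t := by
    refine (map_map (doubleMap θ) (SSet.stdSimplex.objEquiv y) (spread mid t)).symm.trans ?_
    exact congrArg (stdSimplex.map (SSet.stdSimplex.objEquiv y)) (spread_map θ mid t).symm

lemma exists_simplexSubdivision (n : SimplexCategory) :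
    ∃ G : C(TopSimplex n, SSet.toTop.obj (sd (SSet.stdSimplex.{u}.obj n))),
      ∀ {m : SimplexCategory} (y : double m ⟶ n) (t : TopSimplex m),
        G (stdSimplex.map y (spread mid t)) = sdCell (SSet.stdSimplex.objEquiv.symm y) t := by
  obtain ⟨G, hG⟩ := (simplexPieces.{u} n).exists_inverse
    (fun t => by
      obtain ⟨m, y, z, h⟩ := exists_map_spread_mid_eq t
      exact ⟨m, SSet.stdSimplex.objEquiv.symm y, z, h⟩)
    (fun y y' t t' h => by
      obtain ⟨l, f, g, z, hz, rfl, rfl⟩ := exists_hom_map_eq_map_eq t t'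
      rw [← cell_map, ← cell_map]
      exact congrArg (fun w => cell w z)
        (SSet.stdSimplex.objEquiv.injective (doubleMap_comp_eq hz h)))
  exact ⟨G, fun y t => hG (SSet.stdSimplex.objEquiv.symm y) t⟩

lemma exists_subdivision (X : SSet.{u}) :
    ∃ G : C(SSet.toTop.obj X, SSet.toTop.obj (sd X)),
      ∀ {n : SimplexCategory} (z : X.obj (op (double n))) (t : TopSimplex n),
        G (cell z (spread mid t)) = sdCell z t := by
  choose G hG using exists_simplexSubdivision.{u}
  have hcell {n m : SimplexCategory} (x : X.obj (op n)) (y : double m ⟶ n) (t : TopSimplex m) :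
      map (sdMap (SSet.yonedaEquiv.symm x)) (G n (stdSimplex.map y (spread mid t))) =
        sdCell (X.map y.op x) t := by
    rw [hG, map_sdMap_sdCell]
    rfl
  let F : CellFamily X (SSet.toTop.obj (sd X)) :=
    { toFun {n} x := (map (sdMap (SSet.yonedaEquiv.symm x))).comp (G n)
      toFun_map θ x t := by
        obtain ⟨k, y, z, rfl⟩ := exists_map_spread_mid_eq t
        rw [ContinuousMap.comp_apply, ContinuousMap.comp_apply, map_map, hcell, hcell, op_comp,
          X.map_comp]
        rfl }
  refine ⟨F.lift, fun {n} z t => ?_⟩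
  have hid : stdSimplex.map (𝟙 (double n) : double n ⟶ double n) (spread mid t) = spread mid t :=
    stdSimplex.map_id_apply _
  rw [F.lift_cell, ← hid]
  refine (hcell z (𝟙 _) t).trans ?_
  rw [op_id, X.map_id]
  rfl

/-- The canonical homeomorphism from `|X|` to the realization of its edgewise subdivision, as a
continuous map. -/
noncomputable def subdivision (X : SSet.{u}) : C(SSet.toTop.obj X, SSet.toTop.obj (sd X)) :=
  (exists_subdivision X).choose

lemma subdivision_cell {n : SimplexCategory} (z : X.obj (op (double n))) (t : TopSimplex n) :
    subdivision X (cell z (spread mid t)) = sdCell z t :=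
  (exists_subdivision X).choose_spec z t

lemma subdivision_naturality (f : X ⟶ Y) :
    (subdivision Y).comp (map f) = (map (sdMap f)).comp (subdivision X) := by
  ext a
  obtain ⟨n, z, t, rfl⟩ := exists_cell_spread_eq a
  rw [ContinuousMap.comp_apply, ContinuousMap.comp_apply, map_cell, subdivision_cell,
    subdivision_cell, map_sdMap_sdCell]

lemma subdivision_vertexPoint (x : X.obj (op ⦋0⦌)) :
    subdivision X (SSet.vertexPoint X x) = SSet.vertexPoint (sd X) (sdVertex x) := by
  have hx := cell_degenerate x (SimplexCategory.const (double ⦋0⦌) ⦋0⦌ 0)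
    (spread mid (stdSimplex.vertex 0))
  rw [← hx, subdivision_cell, vertexPoint_eq_cell]
  rfl

end Subdivision

section Sweep

variable {X Y : SSet.{u}}

/-- On every simplex of the edgewise subdivision, the path of maps to `|X|` moving all the weight
from the first half to the second one. -/
noncomputable def sweep (X : SSet.{u}) :
    CellFamily (sd X) C(unitInterval, SSet.toTop.obj X) where
  toFun {n} z := ContinuousMap.curry
    ⟨fun q => cell (X := X) (n := double n) z (spread q.2 q.1),
      (cell (X := X) (n := double n) z).continuous.comp (continuous_spread.comp continuous_swap)⟩
  toFun_map θ z t := by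
    ext s
    exact (cell_map (X := X) (doubleMap θ) z (spread s t)).trans
      (congrArg (cell (X := X) z) (spread_map θ s t).symm)

/-- The stage `s` of `sweep`. -/
noncomputable def sweepAt (X : SSet.{u}) (s : unitInterval) :
    C(SSet.toTop.obj (sd X), SSet.toTop.obj X) :=
  ⟨fun a => (sweep X).lift a s, by fun_prop⟩

lemma sweepAt_sdCell {n : SimplexCategory} (z : X.obj (op (double n))) (t : TopSimplex n)
    (s : unitInterval) : sweepAt X s (sdCell z t) = cell z (spread s t) :=
  DFunLike.congr_fun ((sweep X).lift_cell (n := n) z t) s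

lemma sweepAt_sdVertex (x : X.obj (op ⦋0⦌)) (s : unitInterval) :
    sweepAt X s (SSet.vertexPoint (sd X) (sdVertex x)) = SSet.vertexPoint X x := by
  rw [vertexPoint_eq_cell (sdVertex x) (stdSimplex.vertex 0)]
  exact (sweepAt_sdCell (sdVertex x) _ s).trans (cell_degenerate x _ _)

lemma sweepAt_zero (X : SSet.{u}) : sweepAt X 0 = map (sdFirst X) := by
  ext a
  obtain ⟨n, z, t, rfl⟩ := exists_sdCell_eq a
  rw [sweepAt_sdCell, spread_zero, map_sdFirst_sdCell, cell_map]

lemma sweepAt_one (X : SSet.{u}) : sweepAt X 1 = map (sdLast X) := by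
  ext a
  obtain ⟨n, z, t, rfl⟩ := exists_sdCell_eq a
  rw [sweepAt_sdCell, spread_one, map_sdLast_sdCell, cell_map]

lemma sweepAt_mid_comp_subdivision (X : SSet.{u}) :
    (sweepAt X mid).comp (subdivision X) = ContinuousMap.id _ := by
  ext a
  obtain ⟨n, z, t, rfl⟩ := exists_cell_spread_eq a
  rw [ContinuousMap.comp_apply, subdivision_cell, sweepAt_sdCell, ContinuousMap.id_apply]

lemma sweepAt_homotopicRel (x : X.obj (op ⦋0⦌)) (s s' : unitInterval) :
    HomotopicRel (sweepAt X s) (sweepAt X s') {SSet.vertexPoint (sd X) (sdVertex x)} := by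
  have : PathConnectedSpace unitInterval := isPathConnected_iff_pathConnectedSpace.1
    ((convex_Icc (0 : ℝ) 1).isPathConnected ⟨0, unitInterval.zero_mem⟩)
  let γ := PathConnectedSpace.somePath s s'
  exact ⟨{
    toFun q := (sweep X).lift q.2 (γ q.1)
    continuous_toFun := by fun_prop
    map_zero_left a := by rw [γ.source]; rfl
    map_one_left a := by rw [γ.target]; rfl
    prop' r a ha := by
      rw [Set.mem_singleton_iff.1 ha]
      exact (sweepAt_sdVertex x (γ r)).trans (sweepAt_sdVertex x s).symm }⟩

lemma homotopicRel_comp_right {A B C : Type*} [TopologicalSpace A] [TopologicalSpace B]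
    [TopologicalSpace C] {f g : C(B, C)} {S : Set B} (h : HomotopicRel f g S) {T : Set A}
    (k : C(A, B)) (hk : Set.MapsTo k T S) : HomotopicRel (f.comp k) (g.comp k) T := by
  obtain ⟨H⟩ := h
  exact ⟨{
    toFun q := H (q.1, k q.2)
    map_zero_left a := H.map_zero_left (k a)
    map_one_left a := H.map_one_left (k a)
    prop' r a ha := H.prop' r (k a) (hk ha) }⟩

lemma sweepAt_comp_subdivision_homotopicRel (x : X.obj (op ⦋0⦌)) (s s' : unitInterval) :
    HomotopicRel ((sweepAt X s).comp (subdivision X)) ((sweepAt X s').comp (subdivision X))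
      {SSet.vertexPoint X x} :=
  homotopicRel_comp_right (sweepAt_homotopicRel x s s') _
    (Set.mapsTo_singleton.2 (subdivision_vertexPoint x))

lemma sdFirst_comp_subdivision_homotopicRel_id (x : X.obj (op ⦋0⦌)) :
    HomotopicRel ((map (sdFirst X)).comp (subdivision X)) (ContinuousMap.id _)
      {SSet.vertexPoint X x} := by
  rw [← sweepAt_zero, ← sweepAt_mid_comp_subdivision]
  exact sweepAt_comp_subdivision_homotopicRel x 0 mid

lemma sdLast_comp_subdivision_homotopicRel_id (x : X.obj (op ⦋0⦌)) :
    HomotopicRel ((map (sdLast X)).comp (subdivision X)) (ContinuousMap.id _)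
      {SSet.vertexPoint X x} := by
  rw [← sweepAt_one, ← sweepAt_mid_comp_subdivision]
  exact sweepAt_comp_subdivision_homotopicRel x 1 mid

theorem homotopicRel_of_sd {f g : X ⟶ Y} (k : sd X ⟶ sd Y)
    (hf : k ≫ sdFirst Y = sdFirst X ≫ f) (hg : k ≫ sdLast Y = sdLast X ≫ g)
    {x : X.obj (op ⦋0⦌)} (hx : k.app _ (sdVertex x) = sdVertex (f.app _ x)) :
    HomotopicRel (map f) (map g) {SSet.vertexPoint X x} := by
  have hk : Set.MapsTo ((map k).comp (subdivision X)) {SSet.vertexPoint X x}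
      {SSet.vertexPoint (sd Y) (sdVertex (f.app _ x))} := by
    rw [Set.mapsTo_singleton, Set.mem_singleton_iff, ContinuousMap.comp_apply,
      subdivision_vertexPoint, map_vertexPoint, hx]
  have hfirst := (sdFirst_comp_subdivision_homotopicRel_id x).comp_continuousMap (map f)
  have hsweep := homotopicRel_comp_right (sweepAt_homotopicRel (f.app _ x) 0 1) _ hk
  have hlast := (sdLast_comp_subdivision_homotopicRel_id x).comp_continuousMap (map g)
  rw [comp_id, ← comp_assoc, ← map_comp] at hfirst hlast
  rw [sweepAt_zero, sweepAt_one, ← comp_assoc, ← comp_assoc, ← map_comp, ← map_comp, hf, hg]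
    at hsweep
  exact hfirst.symm.trans (hsweep.trans hlast)

end Sweep

end EdgewiseSubdivision

/-! ### Homotopies given by natural transformations -/

namespace SimplicialCat

open Realization EdgewiseSubdivision

section ArrowEval

variable {D : Type*} [Category* D] {D' : Type*} [Category* D'] {J : Type*} [Category* J]

/-- The evaluation of arrows at their sources (over `0`) and targets (over `1`). -/
def arrowEval (D : Type*) [Category* D] : Arrow D × Fin 2 ⥤ D :=
  Functor.uncurry.obj
    { obj f := ComposableArrows.mk₁ f.hom
      map φ := ComposableArrows.homMk₁ φ.left φ.right φ.w.symm
      map_id f := NatTrans.ext (funext fun i => by fin_cases i <;> rfl)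
      map_comp φ φ' := NatTrans.ext (funext fun i => by fin_cases i <;> rfl) }

lemma arrowEval_map_zero {f g : Arrow D} (φ : f ⟶ g) (u : (0 : Fin 2) ⟶ 0) :
    (arrowEval D).map (X := (f, (0 : Fin 2))) (Y := (g, (0 : Fin 2))) (φ, u) = φ.left :=
  Category.comp_id φ.left

lemma arrowEval_map_one {f g : Arrow D} (φ : f ⟶ g) (u : (1 : Fin 2) ⟶ 1) :
    (arrowEval D).map (X := (f, (1 : Fin 2))) (Y := (g, (1 : Fin 2))) (φ, u) = φ.right :=
  Category.comp_id φ.right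

lemma arrowEval_map_zero_one {f g : Arrow D} (φ : f ⟶ g) (u : (0 : Fin 2) ⟶ 1) :
    (arrowEval D).map (X := (f, (0 : Fin 2))) (Y := (g, (1 : Fin 2))) (φ, u) = φ.left ≫ g.hom :=
  rfl

lemma arrowEval_naturality (G : D ⥤ D') :
    arrowEval D ⋙ G = G.mapArrow.prod (𝟭 (Fin 2)) ⋙ arrowEval D' := by
  refine Functor.hext (fun ⟨f, i⟩ => by fin_cases i <;> rfl) ?_
  rintro ⟨f, i⟩ ⟨g, j⟩ ⟨φ, u⟩
  have hij : i ≤ j := leOfHom u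
  fin_cases i <;> fin_cases j
  · exact heq_of_eq ((congrArg G.map (arrowEval_map_zero φ _)).trans
      (arrowEval_map_zero (G.mapArrow.map φ) _).symm)
  · exact heq_of_eq ((congrArg G.map (arrowEval_map_zero_one φ u)).trans (G.map_comp _ _))
  · exact absurd hij (by decide)
  · exact heq_of_eq ((congrArg G.map (arrowEval_map_one φ _)).trans
      (arrowEval_map_one (G.mapArrow.map φ) _).symm)

lemma prod'_const_zero_comp_arrowEval (E : J ⥤ Arrow D) :
    E.prod' ((Functor.const J).obj 0) ⋙ arrowEval D = E ⋙ Arrow.leftFunc :=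
  Functor.hext (fun _ => rfl) fun _ _ _ => heq_of_eq (arrowEval_map_zero _ _)

lemma prod'_const_one_comp_arrowEval (E : J ⥤ Arrow D) :
    E.prod' ((Functor.const J).obj 1) ⋙ arrowEval D = E ⋙ Arrow.rightFunc :=
  Functor.hext (fun _ => rfl) fun _ _ _ => heq_of_eq (arrowEval_map_one _ _)

/-- The functor sending an object to its identity. -/
def arrowId (D : Type*) [Category* D] : D ⥤ Arrow D where
  obj X := Arrow.mk (𝟙 X)
  map f := Arrow.homMk f f

lemma arrowId_comp_mapArrow (G : D ⥤ D') : arrowId D ⋙ G.mapArrow = G ⋙ arrowId D' := by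
  have hmap {x y : D'} {i i' : x ⟶ x} {j j' : y ⟶ y} (hi : i = i') (hj : j = j') (f : x ⟶ y)
      (w : f ≫ j = i ≫ f) (w' : f ≫ j' = i' ≫ f) :
      HEq (Arrow.homMk f f w : Arrow.mk i ⟶ Arrow.mk j)
        (Arrow.homMk f f w' : Arrow.mk i' ⟶ Arrow.mk j') := by
    subst hi hj
    rfl
  exact Functor.hext (fun x => congrArg Arrow.mk (G.map_id x))
    fun x y f => hmap (G.map_id x) (G.map_id y) (G.map f) _ _

lemma prod'_comp_arrowEval_of_id (K : J ⥤ D) (r : J ⥤ Fin 2) :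
    (K ⋙ arrowId D).prod' r ⋙ arrowEval D = K := by
  have hobj (x : D) (i : Fin 2) : (arrowEval D).obj (Arrow.mk (𝟙 x), i) = x := by
    fin_cases i <;> rfl
  have hmap {x y : D} (f : x ⟶ y) {i j : Fin 2} (u : i ⟶ j) :
      HEq ((arrowEval D).map (X := (Arrow.mk (𝟙 x), i)) (Y := (Arrow.mk (𝟙 y), j))
        ((arrowId D).map f, u)) f := by
    have hij := leOfHom u
    fin_cases i <;> fin_cases j
    · exact heq_of_eq (arrowEval_map_zero _ _)
    · exact heq_of_eq ((arrowEval_map_zero_one ((arrowId D).map f) u).trans (Category.comp_id f))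
    · exact absurd hij (by decide)
    · exact heq_of_eq (arrowEval_map_one _ _)
  exact Functor.hext (fun _ => hobj _ _) (fun _ _ _ => hmap _ _)

/-- The functor to the category of arrows given by a natural transformation. -/
def arrowFunctor {F G : J ⥤ D} (η : F ⟶ G) : J ⥤ Arrow D where
  obj j := Arrow.mk (η.app j)
  map f := Arrow.homMk (F.map f) (G.map f) (η.naturality f)

end ArrowEval

/-- The map of diagonals induced by a map of simplicial categories. -/
def diagNerveMap {X X' : SimplexCategoryᵒᵖ ⥤ Cat.{v, u}} (α : X ⟶ X') :
    diagNerve X ⟶ diagNerve X' where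
  app n := (nerveMap (α.app n).toFunctor).app n
  naturality m n θ := by
    ext F
    exact congrArg (fun G : X.obj m ⥤ X'.obj n => (SimplexCategory.toCat.map θ.unop).toFunctor ⋙
      (show Fin (m.unop.len + 1) ⥤ X.obj m from F) ⋙ G)
      (congrArg Cat.Hom.toFunctor (α.naturality θ))

variable (X : SimplexCategoryᵒᵖ ⥤ Cat.{v, max u v})

/-- The simplicial category of arrows of a simplicial category. -/
def arrows : SimplexCategoryᵒᵖ ⥤ Cat.{v, max u v} where
  obj n := Cat.of (Arrow (X.obj n))
  map θ := (X.map θ).toFunctor.mapArrow.toCatHom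
  map_id n := by rw [X.map_id]; rfl
  map_comp θ θ' := by rw [X.map_comp]; rfl

/-- The source of an arrow. -/
def arrowsSource : arrows.{v, u} X ⟶ X where
  app _ := Arrow.leftFunc.toCatHom
  naturality _ _ _ := rfl

/-- The target of an arrow. -/
def arrowsTarget : arrows.{v, u} X ⟶ X where
  app _ := Arrow.rightFunc.toCatHom
  naturality _ _ _ := rfl

/-- The identity arrow. -/
def arrowsId : X ⟶ arrows.{v, u} X where
  app n := (arrowId (X.obj n)).toCatHom
  naturality _ _ θ := congrArg Functor.toCatHom (arrowId_comp_mapArrow (X.map θ).toFunctor).symm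

/-- The map `[n] * [n] ⟶ [1]` separating the two halves. -/
def halves (n : SimplexCategory) : double n ⟶ ⦋1⦌ :=
  copair (SimplexCategory.const n ⦋1⦌ 0) (SimplexCategory.const n ⦋1⦌ 1) fun _ _ => Fin.zero_le _

lemma inl_halves (n : SimplexCategory) : inl n ≫ halves n = SimplexCategory.const n ⦋1⦌ 0 :=
  inl_copair _ _ _

lemma inr_halves (n : SimplexCategory) : inr n ≫ halves n = SimplexCategory.const n ⦋1⦌ 1 :=
  inr_copair _ _ _

lemma doubleMap_comp_halves {m n : SimplexCategory} (θ : m ⟶ n) :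
    doubleMap θ ≫ halves n = halves m := by
  refine double_hom_ext ?_ ?_
  · rw [← Category.assoc, inl_doubleMap, Category.assoc, inl_halves, inl_halves]
    rfl
  · rw [← Category.assoc, inr_doubleMap, Category.assoc, inr_halves, inr_halves]
    rfl

/-- A morphism of the simplex category as a functor between the corresponding linear orders. -/
abbrev homFunctor {m n : SimplexCategory} (θ : m ⟶ n) : Fin (m.len + 1) ⥤ Fin (n.len + 1) :=
  (SimplexCategory.toCat.map θ).toFunctor

lemma homFunctor_comp_prod'_comp_arrowEval {D D' : Type*} [Category* D] [Category* D']
    {m n : SimplexCategory} (θ : m ⟶ n) (E : Fin (n.len + 1) ⥤ Arrow D) (χ : n ⟶ ⦋1⦌)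
    (G : D ⥤ D') :
    homFunctor θ ⋙ (E.prod' (homFunctor χ) ⋙ arrowEval D) ⋙ G =
      (homFunctor θ ⋙ E ⋙ G.mapArrow).prod' (homFunctor (θ ≫ χ)) ⋙ arrowEval D' :=
  congrArg (fun K => homFunctor θ ⋙ E.prod' (homFunctor χ) ⋙ K) (arrowEval_naturality G)

/-- A simplex of `diagNerve X`, as a chain of composable morphisms. -/
abbrev chain {X : SimplexCategoryᵒᵖ ⥤ Cat.{v, u}} {n : SimplexCategoryᵒᵖ}
    (F : (diagNerve X).obj n) : Fin (n.unop.len + 1) ⥤ X.obj n := F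

/-- A chain of arrows of length `[n] * [n]` gives a chain of objects of the same length: the sources
of the first half, followed by the targets of the second half. -/
def zigzag : sd (diagNerve (arrows.{v, u} X)) ⟶ sd (diagNerve X) where
  app n := TypeCat.ofHom fun E =>
    (chain (X := arrows X) (n := op (double n.unop)) E).prod' (homFunctor (halves n.unop)) ⋙
      arrowEval _
  naturality m n θ := by
    ext E
    rw [← doubleMap_comp_halves θ.unop]
    exact (homFunctor_comp_prod'_comp_arrowEval (doubleMap θ.unop)
      (chain (X := arrows X) (n := op (double m.unop)) E) (halves m.unop)
      (X.map (doubleMap θ.unop).op).toFunctor).symm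

lemma zigzag_comp_sdFirst :
    zigzag.{v, u} X ≫ sdFirst (diagNerve X) =
      sdFirst (diagNerve (arrows X)) ≫ diagNerveMap (arrowsSource X) := by
  ext n E
  refine (homFunctor_comp_prod'_comp_arrowEval (inl n.unop)
    (chain (X := arrows X) (n := op (double n.unop)) E) (halves n.unop)
    (X.map (inl n.unop).op).toFunctor).trans ?_
  rw [inl_halves]
  exact prod'_const_zero_comp_arrowEval _

lemma zigzag_comp_sdLast :
    zigzag.{v, u} X ≫ sdLast (diagNerve X) =
      sdLast (diagNerve (arrows X)) ≫ diagNerveMap (arrowsTarget X) := by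
  ext n E
  refine (homFunctor_comp_prod'_comp_arrowEval (inr n.unop)
    (chain (X := arrows X) (n := op (double n.unop)) E) (halves n.unop)
    (X.map (inr n.unop).op).toFunctor).trans ?_
  rw [inr_halves]
  exact prod'_const_one_comp_arrowEval _

variable {X}

theorem homotopicRel_of_arrows {Z : SSet.{max u v}} (E : Z ⟶ diagNerve (arrows.{v, u} X))
    {x : Z.obj (op ⦋0⦌)} {y : (diagNerve X).obj (op ⦋0⦌)}
    (hxy : E.app _ x = (diagNerveMap (arrowsId X)).app _ y) :
    HomotopicRel (map (E ≫ diagNerveMap (arrowsSource X)))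
      (map (E ≫ diagNerveMap (arrowsTarget X))) {SSet.vertexPoint Z x} := by
  refine homotopicRel_of_sd (sdMap E ≫ zigzag X) ?_ ?_ ?_
  · rw [Category.assoc, zigzag_comp_sdFirst, ← Category.assoc, sdMap_comp_sdFirst, Category.assoc]
  · rw [Category.assoc, zigzag_comp_sdLast, ← Category.assoc, sdMap_comp_sdLast, Category.assoc]
  · have hvertex : (sdMap E).app _ (sdVertex x) =
        (sdMap (diagNerveMap (arrowsId X))).app _ (sdVertex y) := by
      rw [app_sdVertex, app_sdVertex, hxy]
    have hsource : (E ≫ diagNerveMap (arrowsSource X)).app _ x = y :=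
      congrArg ((diagNerveMap (arrowsSource X)).app _) hxy
    rw [hsource]
    refine (congrArg ((zigzag X).app _) hvertex).trans ?_
    exact prod'_comp_arrowEval_of_id
      (chain (X := X) (n := op (double ⦋0⦌)) (sdVertex (X := diagNerve X) y)) _

end SimplicialCat

/-! ### Loop spaces -/

section Loops

variable {A B : Type*} [TopologicalSpace A] [TopologicalSpace B] {a : A} {b : B}

/-- The map of loop spaces induced by a based map. -/
def loopMap (f : C(A, B)) (hf : f a = b) : C(LoopSpace A a, LoopSpace B b) where
  toFun γ := ⟨f.comp γ.toContinuousMap, by simp [hf], by simp [hf]⟩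
  continuous_toFun := continuous_induced_rng.2 ((continuous_postcomp f).comp continuous_induced_dom)

lemma loopMap_homotopic {f g : C(A, B)} (hf : f a = b) (hg : g a = b)
    (h : HomotopicRel f g {a}) : (loopMap f hf).Homotopic (loopMap g hg) := by
  obtain ⟨H⟩ := h
  have hbase (s : unitInterval) : H (s, a) = b := (H.prop' s a rfl).trans hf
  refine ⟨⟨⟨fun q => ⟨⟨fun t => H (q.1, q.2 t), by fun_prop⟩, by simp [hbase], by simp [hbase]⟩,
    ?_⟩, fun γ => ?_, fun γ => ?_⟩⟩
  · refine continuous_induced_rng.2 (ContinuousMap.continuous_of_continuous_uncurry _ ?_)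
    change Continuous fun q : (unitInterval × LoopSpace A a) × unitInterval => H (q.1.1, q.1.2 q.2)
    fun_prop
  · ext t
    exact H.map_zero_left (γ t)
  · ext t
    exact H.map_one_left (γ t)

end Loops

/-! ### Quotients of cofibrations -/

namespace WaldhausenCategory

variable {C : Type u} [Category.{v} C] {W : WaldhausenCategory C}

variable (W) in
/-- `q` exhibits `Q` as the quotient `B / A` along `f`, i.e. as the pushout of `f` along the map to
the zero object. -/
def IsQuotient {A B Q : C} (f : A ⟶ B) (q : B ⟶ Q) : Prop :=
  IsPushout f (W.isZero_zero.from_ A) q (W.isZero_zero.to_ Q)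

section IsQuotient

variable {A B Q A' B' Q' : C} {f : A ⟶ B} {q : B ⟶ Q} {f' : A' ⟶ B'} {q' : B' ⟶ Q'}

lemma IsQuotient.of_isPushout {Z : C} (hZ : Limits.IsZero Z) {g : A ⟶ Z} {i : Z ⟶ Q}
    (h : IsPushout f g q i) : W.IsQuotient f q :=
  IsPushout.of_iso h (Iso.refl _) (Iso.refl _) (hZ.iso W.isZero_zero) (Iso.refl _)
    (by simp) (W.isZero_zero.eq_of_tgt _ _) (by simp) (hZ.eq_of_src _ _)

lemma IsQuotient.hom_ext (h : W.IsQuotient f q) {X : C} {s t : Q ⟶ X} (e : q ≫ s = q ≫ t) :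
    s = t :=
  IsPushout.hom_ext h e (W.isZero_zero.eq_of_src _ _)

lemma IsQuotient.comp_comp_eq (h : W.IsQuotient f q) {X : C} (a : X ⟶ A) :
    a ≫ f ≫ q = W.isZero_zero.from_ X ≫ W.isZero_zero.to_ Q := by
  rw [h.toCommSq.w, ← Category.assoc]
  exact congrArg (· ≫ _) (W.isZero_zero.eq_of_tgt _ _)

/-- The map of quotients induced by a commutative square. -/
noncomputable def IsQuotient.map (h : W.IsQuotient f q) (h' : W.IsQuotient f' q') (a : A ⟶ A')
    (b : B ⟶ B') (w : f ≫ b = a ≫ f') : Q ⟶ Q' :=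
  IsPushout.desc h (b ≫ q') (W.isZero_zero.to_ Q') (by
    rw [← Category.assoc, w, Category.assoc, h'.comp_comp_eq])

lemma IsQuotient.comp_map (h : W.IsQuotient f q) (h' : W.IsQuotient f' q') (a : A ⟶ A')
    (b : B ⟶ B') (w : f ≫ b = a ≫ f') : q ≫ h.map h' a b w = b ≫ q' :=
  IsPushout.inl_desc _ _ _ _

lemma IsQuotient.isIso_of_comp_eq {r : B ⟶ Q'} (h : W.IsQuotient f q) (h' : W.IsQuotient f r)
    {p : Q ⟶ Q'} (hp : q ≫ p = r) : IsIso p := by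
  have hiso : p = (IsPushout.isoIsPushout _ _ h h').hom :=
    h.hom_ext (hp.trans (IsPushout.inl_isoIsPushout_hom _ _ h h').symm)
  rw [hiso]
  infer_instance

lemma IsQuotient.isPushout_comp {D R : C} {g : B ⟶ D} {r : D ⟶ R} (h : W.IsQuotient f q)
    (h' : W.IsQuotient (f ≫ g) r) {p : Q ⟶ R} (hp : q ≫ p = g ≫ r) : IsPushout g q r p := by
  have hzero : W.isZero_zero.to_ Q ≫ p = W.isZero_zero.to_ R := W.isZero_zero.eq_of_src _ _
  refine IsPushout.of_left (h₁₁ := f) (v₁₁ := W.isZero_zero.from_ A)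
    (h₂₁ := W.isZero_zero.to_ Q) ?_ hp.symm h
  rw [hzero]
  exact h'

lemma IsQuotient.exists_of_isPushout {a : A ⟶ A'} {P : C} {inl : B ⟶ P} {inr : A' ⟶ P}
    (h : W.IsQuotient f q) (hP : IsPushout f a inl inr) :
    ∃ r : P ⟶ Q, W.IsQuotient inr r ∧ inl ≫ r = q := by
  have hw : f ≫ q = a ≫ W.isZero_zero.from_ A' ≫ W.isZero_zero.to_ Q := by
    rw [← Category.id_comp (f ≫ q), h.comp_comp_eq, ← Category.assoc]
    exact congrArg (· ≫ _) (W.isZero_zero.eq_of_tgt _ _)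
  have hzero : a ≫ W.isZero_zero.from_ A' = W.isZero_zero.from_ A := W.isZero_zero.eq_of_tgt _ _
  refine ⟨hP.desc q _ hw, IsPushout.flip (IsPushout.of_left (h₁₁ := a) (v₁₁ := f) (v₁₂ := inr)
    (h₂₁ := inl) ?_ (by simp) hP.flip), hP.inl_desc _ _ _⟩
  rw [hzero, IsPushout.inl_desc]
  exact IsPushout.flip h

lemma IsQuotient.weq_of_isDist (h : W.IsQuotient f q) (h' : W.IsQuotient f' q') (hf : W.cof f)
    (hf' : W.cof f') {a : A ⟶ A'} {b : B ⟶ B'} (H : W.IsDist f f' a b) {p : Q ⟶ Q'}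
    (hp : q ≫ p = b ≫ q') : W.weq p := by
  obtain ⟨P, inl, inr, hP, t, rfl, rfl, ht⟩ := H.exists_of hf
  obtain ⟨r, hr, rfl⟩ := h.exists_of_isPushout hP
  have hrp : r ≫ p = t ≫ q' := by
    apply hP.hom_ext
    · simpa only [Category.assoc] using hp
    · rw [← Category.id_comp (inr ≫ r ≫ p), ← Category.id_comp (inr ≫ t ≫ q'),
        ← Category.assoc inr r p, ← Category.assoc (𝟙 A'), hr.comp_comp_eq,
        ← Category.assoc inr t q', h'.comp_comp_eq, Category.assoc]
      exact congrArg (_ ≫ ·) (W.isZero_zero.eq_of_src _ _)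
  exact W.gluing hr h' (W.cof_pushout hP hf) hf' (a := 𝟙 _) (b := t) (d := 𝟙 _) (by simp)
    (by simp) hrp (W.isZero_zero.eq_of_src _ _) (W.weq_of_isIso _) ht (W.weq_of_isIso _)

end IsQuotient

section Chosen

variable {A B : C} (f : A ⟶ B)

lemma exists_isQuotient (hf : W.cof f) :
    ∃ (Q : C) (q : B ⟶ Q), W.IsQuotient f q ∧ (IsIso f → Q = W.zero) := by
  by_cases h : IsIso f
  · have : IsIso (W.isZero_zero.to_ W.zero) :=
      ⟨W.isZero_zero.from_ W.zero, W.isZero_zero.eq_of_src _ _, W.isZero_zero.eq_of_src _ _⟩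
    exact ⟨W.zero, W.isZero_zero.from_ B,
      IsPushout.of_horiz_isIso ⟨W.isZero_zero.eq_of_tgt _ _⟩, fun _ => rfl⟩
  · have := W.hasPushout f (W.isZero_zero.from_ A) hf
    exact ⟨_, _, IsQuotient.of_isPushout W.isZero_zero
      (IsPushout.of_hasPushout f (W.isZero_zero.from_ A)), fun h' => absurd h' h⟩

variable (W) in
/-- A chosen quotient of a cofibration. It is equal, and not just isomorphic, to the zero object for
isomorphisms, as the diagonal entries of the objects of the `S`-construction have to be. -/
noncomputable def quot (hf : W.cof f) : C := (exists_isQuotient f hf).choose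

variable (W) in
/-- The map to the chosen quotient. -/
noncomputable def toQuot (hf : W.cof f) : B ⟶ W.quot f hf :=
  (exists_isQuotient f hf).choose_spec.choose

lemma isQuotient_toQuot (hf : W.cof f) : W.IsQuotient f (W.toQuot f hf) :=
  (exists_isQuotient f hf).choose_spec.choose_spec.1

lemma quot_eq_zero (hf : W.cof f) [IsIso f] : W.quot f hf = W.zero :=
  (exists_isQuotient f hf).choose_spec.choose_spec.2 inferInstance

end Chosen

lemma isDist_of_weq {A B A' B' : C} {f : A ⟶ B} {f' : A' ⟶ B'} {a : A ⟶ A'} {b : B ⟶ B'}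
    (hf : W.cof f) (hf' : W.cof f') (w : f ≫ b = a ≫ f') (ha : W.weq a) (hb : W.weq b) :
    W.IsDist f f' a b := by
  have := W.hasPushout f a hf
  have hP := IsPushout.of_hasPushout f a
  have hB : IsPushout f' (𝟙 A') (𝟙 B') f' := IsPushout.of_vert_isIso ⟨by simp⟩
  refine IsDist.mk_of hP (hP.desc b f' w) (by simp) (by simp) ?_
  exact W.gluing hP hB hf hf' (a := a) (b := b) (d := 𝟙 A') w (by simp) (by simp) (by simp)
    ha hb (W.weq_of_isIso _)

lemma isDist_of_isPushout {A B A' B' : C} {f : A ⟶ B} {f' : A' ⟶ B'} {a : A ⟶ A'} {b : B ⟶ B'}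
    (h : IsPushout f a b f') : W.IsDist f f' a b :=
  IsDist.mk_of h (𝟙 _) (by simp) (by simp) (W.weq_of_isIso _)

/-! ### The diagram of quotients of a horizontal functor -/

section HFun

variable {J : Type} [Category.{0} J] {F G : W.squaresCategory.HFun J}

/-- An object of a horizontal functor, as an object of `C`. -/
def horObj (F : W.squaresCategory.HFun J) (j : J) : C := F.functor.obj j

/-- A map of a horizontal functor, as a morphism of `C`. -/
def horMap (F : W.squaresCategory.HFun J) {i j : J} (f : i ⟶ j) : horObj F i ⟶ horObj F j :=
  (F.functor.map f).1

lemma cof_horMap (F : W.squaresCategory.HFun J) {i j : J} (f : i ⟶ j) : W.cof (horMap F f) :=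
  (F.functor.map f).2

lemma horMap_id (F : W.squaresCategory.HFun J) (i : J) : horMap F (𝟙 i) = 𝟙 (horObj F i) :=
  congrArg Subtype.val (F.functor.map_id i)

lemma horMap_comp (F : W.squaresCategory.HFun J) {i j k : J} (f : i ⟶ j) (g : j ⟶ k) :
    horMap F (f ≫ g) = horMap F f ≫ horMap F g :=
  congrArg Subtype.val (F.functor.map_comp f g)

/-- A component of a morphism of horizontal functors, as a morphism of `C`. -/
def verMap (α : F ⟶ G) (j : J) : horObj F j ⟶ horObj G j :=
  SquaresCategory.HFun.Hom.app α j

lemma isDist_verMap (α : F ⟶ G) {i j : J} (f : i ⟶ j) :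
    W.IsDist (horMap F f) (horMap G f) (verMap α i) (verMap α j) :=
  SquaresCategory.HFun.Hom.dist α f

lemma horMap_comp_verMap (α : F ⟶ G) {i j : J} (f : i ⟶ j) :
    horMap F f ≫ verMap α j = verMap α i ≫ horMap G f :=
  (isDist_verMap α f).1

/-- The horizontal functor given by a functor whose values on morphisms are cofibrations. -/
def hFunOfFunctor (F : J ⥤ C) (h : ∀ {i j : J} (f : i ⟶ j), W.cof (F.map f)) :
    W.squaresCategory.HFun J where
  functor :=
    { obj := fun j => F.obj j
      map := fun f => ⟨F.map f, h f⟩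
      map_id := fun i => Subtype.ext (F.map_id i)
      map_comp := fun f g => Subtype.ext (F.map_comp f g) }

/-- The morphism of horizontal functors with given components in `C`. -/
def hFunHom (app : ∀ j, horObj F j ⟶ horObj G j)
    (dist : ∀ {i j : J} (f : i ⟶ j), W.IsDist (horMap F f) (horMap G f) (app i) (app j)) : F ⟶ G :=
  SquaresCategory.HFun.Hom.mk app dist

lemma hFun_hom_ext {α β : F ⟶ G} (h : ∀ j, verMap α j = verMap β j) : α = β :=
  SquaresCategory.HFun.Hom.ext (funext h)

lemma horMap_hom_comp_right (F : W.squaresCategory.HFun J) {x y : Arrow J} (φ : x ⟶ y) :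
    horMap F x.hom ≫ horMap F φ.right = horMap F φ.left ≫ horMap F y.hom := by
  rw [← horMap_comp, ← horMap_comp]
  exact congrArg (horMap F) φ.w.symm

/-- The diagram `(i ⟶ j) ↦ F j / F i`. -/
noncomputable def quotDiagram (F : W.squaresCategory.HFun J) : Arrow J ⥤ C where
  obj x := W.quot (horMap F x.hom) (cof_horMap F _)
  map φ := (isQuotient_toQuot _ _).map (isQuotient_toQuot _ _) (horMap F φ.left)
    (horMap F φ.right) (horMap_hom_comp_right F φ)
  map_id x := (isQuotient_toQuot _ _).hom_ext (by
    rw [IsQuotient.comp_map, Arrow.id_right, horMap_id, Category.id_comp, Category.comp_id])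
  map_comp φ φ' := (isQuotient_toQuot _ _).hom_ext (by
    rw [IsQuotient.comp_map, ← Category.assoc, IsQuotient.comp_map, Category.assoc,
      IsQuotient.comp_map, ← Category.assoc, Arrow.comp_right, horMap_comp])

/-- The projection `F j ⟶ F j / F i`. -/
noncomputable def quotProj (F : W.squaresCategory.HFun J) (x : Arrow J) :
    horObj F x.right ⟶ (quotDiagram F).obj x :=
  W.toQuot (horMap F x.hom) (cof_horMap F _)

lemma isQuotient_quotProj (F : W.squaresCategory.HFun J) (x : Arrow J) :
    W.IsQuotient (horMap F x.hom) (quotProj F x) :=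
  isQuotient_toQuot _ _

lemma quotProj_comp_map (F : W.squaresCategory.HFun J) {x y : Arrow J} (φ : x ⟶ y) :
    quotProj F x ≫ (quotDiagram F).map φ = horMap F φ.right ≫ quotProj F y :=
  (isQuotient_quotProj F x).comp_map (isQuotient_quotProj F y) (horMap F φ.left)
    (horMap F φ.right) (horMap_hom_comp_right F φ)

lemma quotProj_comp_map_of_right_eq_id (F : W.squaresCategory.HFun J) {i i' j : J} {f : i ⟶ j}
    {f' : i' ⟶ j} (φ : Arrow.mk f ⟶ Arrow.mk f') (hφ : φ.right = 𝟙 j) :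
    quotProj F (Arrow.mk f) ≫ (quotDiagram F).map φ = quotProj F (Arrow.mk f') := by
  have hid : horMap F φ.right = 𝟙 (horObj F j) :=
    (congrArg (fun g : j ⟶ j => horMap F g) hφ).trans (horMap_id F j)
  exact (quotProj_comp_map F φ).trans ((congrArg (· ≫ _) hid).trans (Category.id_comp _))

lemma quotDiagram_obj_id (F : W.squaresCategory.HFun J) (j : J) :
    (quotDiagram F).obj (Arrow.mk (𝟙 j)) = W.zero := by
  have : IsIso (horMap F (𝟙 j)) := by
    rw [horMap_id]
    infer_instance
  exact quot_eq_zero (horMap F (𝟙 j)) (cof_horMap F (𝟙 j))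

lemma isPushout_quotProj (F : W.squaresCategory.HFun J) {i j k : J} {f : i ⟶ j} {g : j ⟶ k}
    {fg : i ⟶ k} (h : f ≫ g = fg) :
    IsPushout (horMap F g) (quotProj F (Arrow.mk f)) (quotProj F (Arrow.mk fg))
      ((quotDiagram F).map (Arrow.homMk (𝟙 i) g ((Category.id_comp fg).trans h.symm))) := by
  subst h
  refine (isQuotient_quotProj F (Arrow.mk f)).isPushout_comp ?_ (quotProj_comp_map F _)
  rw [← horMap_comp]
  exact isQuotient_quotProj F (Arrow.mk (f ≫ g))

lemma isPushout_quotDiagram (F : W.squaresCategory.HFun J) {i j k : J} (f : i ⟶ j) (g : j ⟶ k) :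
    IsPushout
      ((quotDiagram F).map (Arrow.homMk (𝟙 i) g : Arrow.mk f ⟶ Arrow.mk (f ≫ g)))
      ((quotDiagram F).map (Arrow.homMk f (𝟙 j) : Arrow.mk f ⟶ Arrow.mk (𝟙 j)))
      ((quotDiagram F).map (Arrow.homMk f (𝟙 k) : Arrow.mk (f ≫ g) ⟶ Arrow.mk g))
      ((quotDiagram F).map (Arrow.homMk (𝟙 j) g : Arrow.mk (𝟙 j) ⟶ Arrow.mk g)) := by
  refine IsPushout.of_top (h₁₁ := horMap F g) (v₁₁ := quotProj F (Arrow.mk f))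
    (v₁₂ := quotProj F (Arrow.mk (f ≫ g))) ?_ ?_ (isPushout_quotProj F rfl)
  · rw [quotProj_comp_map_of_right_eq_id F _ rfl, quotProj_comp_map_of_right_eq_id F _ rfl]
    exact isPushout_quotProj F (Category.id_comp g)
  · rw [← Functor.map_comp, ← Functor.map_comp]
    exact congrArg _ (Arrow.hom_ext _ _ (by simp) (by simp))

/-- The map `F j / F i ⟶ G j / G i` induced by a morphism of horizontal functors. -/
noncomputable def quotApp (α : F ⟶ G) (x : Arrow J) :
    (quotDiagram F).obj x ⟶ (quotDiagram G).obj x :=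
  (isQuotient_quotProj F x).map (isQuotient_quotProj G x) (verMap α x.left) (verMap α x.right)
    (horMap_comp_verMap α x.hom)

lemma quotProj_comp_quotApp (α : F ⟶ G) (x : Arrow J) :
    quotProj F x ≫ quotApp α x = verMap α x.right ≫ quotProj G x :=
  (isQuotient_quotProj F x).comp_map _ _ _ _

lemma weq_quotApp (α : F ⟶ G) (x : Arrow J) : W.weq (quotApp α x) :=
  (isQuotient_quotProj F x).weq_of_isDist (isQuotient_quotProj G x) (cof_horMap F _)
    (cof_horMap G _) (isDist_verMap α x.hom) (quotProj_comp_quotApp α x)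

/-- The map of diagrams of quotients induced by a morphism of horizontal functors. -/
noncomputable def quotNatTrans (α : F ⟶ G) : quotDiagram F ⟶ quotDiagram G where
  app := quotApp α
  naturality x y φ := (isQuotient_quotProj F x).hom_ext (by
    rw [← Category.assoc, quotProj_comp_map, Category.assoc, quotProj_comp_quotApp,
      ← Category.assoc (quotProj F x), quotProj_comp_quotApp, Category.assoc, quotProj_comp_map,
      ← Category.assoc, ← Category.assoc, horMap_comp_verMap])

lemma quotApp_id (F : W.squaresCategory.HFun J) (x : Arrow J) : quotApp (𝟙 F) x = 𝟙 _ :=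
  (isQuotient_quotProj F x).hom_ext ((quotProj_comp_quotApp _ x).trans
    ((Category.id_comp (quotProj F x)).trans (Category.comp_id _).symm))

lemma quotApp_comp {H : W.squaresCategory.HFun J} (α : F ⟶ G) (β : G ⟶ H) (x : Arrow J) :
    quotApp (α ≫ β) x = quotApp α x ≫ quotApp β x := by
  have hverMap : verMap (α ≫ β) x.right = verMap α x.right ≫ verMap β x.right := rfl
  refine (isQuotient_quotProj F x).hom_ext ?_
  rw [quotProj_comp_quotApp, hverMap, ← Category.assoc (quotProj F x), quotProj_comp_quotApp,
    Category.assoc, Category.assoc, quotProj_comp_quotApp]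

end HFun

section QuotS

variable {n : ℕ}

/-- The object of the `S`-construction with entries `F j / F i`. -/
noncomputable def quotSObj (F : W.squaresCategory.HFun (Fin (n + 1))) : W.SObj n where
  functor := quotDiagram F
  obj_diag := quotDiagram_obj_id F
  cof_map _ g := W.cof_pushout (isPushout_quotProj F rfl) (cof_horMap F g)
  isPushout := isPushout_quotDiagram F

/-- The functor `T_n C' ⥤ wS_n C` forming the quotients `F j / F i`. -/
noncomputable def quotSFunctor (n : ℕ) : W.squaresCategory.HFun (Fin (n + 1)) ⥤ W.SObj n where
  obj F := quotSObj F
  map α := SObj.Hom.mk (quotNatTrans α) (weq_quotApp α)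
  map_id F := SObj.Hom.ext (NatTrans.ext (funext (quotApp_id F)))
  map_comp α β := SObj.Hom.ext (NatTrans.ext (funext (quotApp_comp α β)))

variable (W) in
/-- The map of simplicial categories `T_• C' ⟶ wS_• C` forming the quotients `F j / F i`. -/
noncomputable def quotT : W.squaresCategory.T ⟶ W.wS where
  app n := (quotSFunctor n.unop.len).toCatHom
  naturality _ _ _ := rfl

end QuotS

/-! ### The rows of a diagram of the `S`-construction -/

section ArrowOfLE

variable {P : Type*} [Preorder P]

/-- The arrow `i ≤ j`. -/
abbrev arrowOfLE {i j : P} (h : i ≤ j) : Arrow P := Arrow.mk (homOfLE h)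

/-- The morphism from `i ≤ j` to `i ≤ k`. -/
abbrev raiseTarget {i j k : P} (h : i ≤ j) (hjk : j ≤ k) : arrowOfLE h ⟶ arrowOfLE (h.trans hjk) :=
  Arrow.homMk (𝟙 i) (homOfLE hjk)

/-- The morphism from `i ≤ j` to `i' ≤ j`. -/
abbrev raiseSource {i i' j : P} (hi : i ≤ i') (h : i' ≤ j) : arrowOfLE (hi.trans h) ⟶ arrowOfLE h :=
  Arrow.homMk (homOfLE hi) (𝟙 j)

instance (x y : Arrow P) : Subsingleton (x ⟶ y) :=
  ⟨fun f g => Arrow.hom_ext f g (Subsingleton.elim _ _) (Subsingleton.elim _ _)⟩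

end ArrowOfLE

section SObj

variable {m : ℕ} (A : W.SObj m) {i i' j k : Fin (m + 1)}

lemma cof_map_raiseTarget (h : i ≤ j) (hjk : j ≤ k) :
    W.cof (A.functor.map (raiseTarget h hjk)) :=
  A.cof_map (homOfLE h) (homOfLE hjk)

lemma isQuotient_map_raiseTarget (h : i ≤ j) (hjk : j ≤ k) :
    W.IsQuotient (A.functor.map (raiseTarget h hjk)) (A.functor.map (raiseSource h hjk)) := by
  have hzero : Limits.IsZero (A.functor.obj (Arrow.mk (𝟙 j))) := by
    rw [A.obj_diag]
    exact W.isZero_zero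
  exact IsQuotient.of_isPushout hzero (A.isPushout (homOfLE h) (homOfLE hjk))

lemma isPushout_map_raise (hi : i ≤ i') (h : i' ≤ j) (hjk : j ≤ k) :
    IsPushout (A.functor.map (raiseTarget (hi.trans h) hjk)) (A.functor.map (raiseSource hi h))
      (A.functor.map (raiseSource hi (h.trans hjk))) (A.functor.map (raiseTarget h hjk)) := by
  refine (isQuotient_map_raiseTarget A hi h).isPushout_comp ?_ ?_
  · rw [← Functor.map_comp]
    exact isQuotient_map_raiseTarget A hi (h.trans hjk)
  · rw [← Functor.map_comp, ← Functor.map_comp]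
    exact congrArg _ (Subsingleton.elim _ _)

lemma map_raiseSource_comp_natTrans {A A' : W.SObj m} (α : A ⟶ A') (hi : i ≤ i') (h : i' ≤ j)
    (hjk : j ≤ k) :
    A.functor.map (raiseSource hi (h.trans hjk)) ≫
        (SObj.Hom.natTrans α).app (arrowOfLE (h.trans hjk)) ≫
          A'.functor.map (raiseSource h hjk) =
      A.functor.map (raiseSource (hi.trans h) hjk) ≫
        (SObj.Hom.natTrans α).app (arrowOfLE hjk) := by
  rw [← (SObj.Hom.natTrans α).naturality, ← Category.assoc, ← CategoryTheory.Functor.map_comp]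
  rfl

end SObj

section Row

variable {J : Type} [Category.{0} J] {m : ℕ} {i i' i'' : Fin (m + 1)} {R : J ⥤ Fin (m + 1)}

/-- The part `j ↦ A_{i, R j}` of the row `i` of a diagram of the `S`-construction. -/
def row (A : W.SObj m) (i : Fin (m + 1)) (R : J ⥤ Fin (m + 1)) (h : ∀ j, i ≤ R.obj j) :
    W.squaresCategory.HFun J :=
  hFunOfFunctor
    { obj := fun j => A.functor.obj (arrowOfLE (h j))
      map := fun f => A.functor.map (raiseTarget (h _) (leOfHom (R.map f)))
      map_id := fun j => by
        rw [Subsingleton.elim (raiseTarget _ _) (𝟙 (arrowOfLE (h j))),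
          CategoryTheory.Functor.map_id]
      map_comp := fun f g => by
        rw [← Functor.map_comp]
        exact congrArg _ (Subsingleton.elim _ _) }
    (fun {j _} f => cof_map_raiseTarget A (h j) (leOfHom (R.map f)))

/-- The component `A_{i, R j} ⟶ A_{i', R j} ⟶ A'_{i', R j}` of the map of rows `rowChange`. -/
def rowChangeApp {A A' : W.SObj m} (α : A ⟶ A') (hi : i ≤ i') (h : ∀ j, i' ≤ R.obj j) (j : J) :
    A.functor.obj (arrowOfLE (hi.trans (h j))) ⟶ A'.functor.obj (arrowOfLE (h j)) :=
  A.functor.map (raiseSource hi (h j)) ≫ (SObj.Hom.natTrans α).app (arrowOfLE (h j))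

lemma rowChangeApp_id (A : W.SObj m) (h : ∀ j, i ≤ R.obj j) (j : J) :
    rowChangeApp (𝟙 A) le_rfl h j = 𝟙 _ := by
  have hid : (SObj.Hom.natTrans (𝟙 A)).app (arrowOfLE (h j)) = 𝟙 _ := rfl
  rw [rowChangeApp, Subsingleton.elim (raiseSource _ _) (𝟙 (arrowOfLE (h j))),
    CategoryTheory.Functor.map_id, Category.id_comp, hid]

lemma rowChangeApp_comp {A A' A'' : W.SObj m} (α : A ⟶ A') (β : A' ⟶ A'') (hi : i ≤ i')
    (hi' : i' ≤ i'') (h : ∀ j, i'' ≤ R.obj j) (j : J) :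
    rowChangeApp (α ≫ β) (hi.trans hi') h j =
      rowChangeApp α hi (fun j => hi'.trans (h j)) j ≫ rowChangeApp β hi' h j := by
  have hcomp : (SObj.Hom.natTrans (α ≫ β)).app (arrowOfLE (h j)) =
    (SObj.Hom.natTrans α).app _ ≫ (SObj.Hom.natTrans β).app _ := rfl
  have hraise : raiseSource (hi.trans hi') (h j) =
      raiseSource hi (hi'.trans (h j)) ≫ raiseSource hi' (h j) :=
    Subsingleton.elim _ _
  simp only [rowChangeApp]
  rw [hcomp, hraise, Functor.map_comp, Category.assoc, Category.assoc,
    (SObj.Hom.natTrans α).naturality_assoc]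

/-- The map from the row `i` of `A` to a later row `i'` of `A'` induced by a map `A ⟶ A'`. -/
def rowChange {A A' : W.SObj m} (α : A ⟶ A') (hi : i ≤ i') (h : ∀ j, i' ≤ R.obj j) :
    row A i R (fun j => hi.trans (h j)) ⟶ row A' i' R h :=
  hFunHom (rowChangeApp α hi h) fun {j j'} f => by
    have hR : R.obj j ≤ R.obj j' := leOfHom (R.map f)
    exact IsDist.vcomp (cof_map_raiseTarget A (hi.trans (h j)) hR) (cof_map_raiseTarget A (h j) hR)
      (isDist_of_isPushout (isPushout_map_raise A hi (h j) hR))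
      (isDist_of_weq (cof_map_raiseTarget A (h j) hR) (cof_map_raiseTarget A' (h j) hR)
        ((SObj.Hom.natTrans α).naturality _) (SObj.Hom.weq α _) (SObj.Hom.weq α _))

/-- The chain of rows `j ↦ A^{R j}_{L j, R _}` of a chain of diagrams `A`. -/
def grid (z : Fin (m + 1) ⥤ W.SObj m) (L R : J ⥤ Fin (m + 1)) (h : ∀ i j, L.obj i ≤ R.obj j) :
    J ⥤ W.squaresCategory.HFun J where
  obj i := row (z.obj (R.obj i)) (L.obj i) R (h i)
  map {_ i'} f := rowChange (z.map (R.map f)) (leOfHom (L.map f)) (h i')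
  map_id i := hFun_hom_ext fun j =>
    (congrArg (fun α => rowChangeApp α le_rfl (h i) j)
      ((congrArg z.map (R.map_id i)).trans (z.map_id _))).trans (rowChangeApp_id _ (h i) j)
  map_comp {_ _ i''} f g := hFun_hom_ext fun j =>
    (congrArg (fun α => rowChangeApp α (leOfHom (L.map (f ≫ g))) (h i'') j)
      ((congrArg z.map (R.map_comp f g)).trans (z.map_comp _ _))).trans
      (rowChangeApp_comp _ _ (leOfHom (L.map f)) (leOfHom (L.map g)) (h i'') j)

end Row

/-! ### The two comparisons with the last half -/

section Proj

variable {J : Type} [Category.{0} J] {m : ℕ}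

/-- The projections `F (R j) ⟶ F (R j) / F i` to a row of the diagram of quotients of `F`. -/
noncomputable def projRow (F : W.squaresCategory.HFun (Fin (m + 1))) (i : Fin (m + 1))
    (R : J ⥤ Fin (m + 1)) (h : ∀ j, i ≤ R.obj j) :
    (SquaresCategory.HFun.precomp R).obj F ⟶ row (quotSObj F) i R h :=
  hFunHom (fun j => quotProj F (arrowOfLE (h j))) fun {j _} f =>
    isDist_of_isPushout (isPushout_quotProj F (Subsingleton.elim (homOfLE (h j) ≫ R.map f) _))

lemma verMap_comp_quotProj {P : Type} [Preorder P] {F G : W.squaresCategory.HFun P} (α : F ⟶ G)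
    {i i' j : P} (hi : i ≤ i') (h : i' ≤ j) :
    verMap α j ≫ quotProj G (arrowOfLE h) =
      quotProj F (arrowOfLE (hi.trans h)) ≫
        (quotDiagram F).map (raiseSource hi h) ≫ quotApp α (arrowOfLE h) := by
  rw [← Category.assoc, quotProj_comp_map_of_right_eq_id F _ rfl, quotProj_comp_quotApp]
  rfl

/-- The natural transformation from the last half of a chain in `T_• C'` to its grid of
quotients. -/
noncomputable def projGrid (z : Fin (m + 1) ⥤ W.squaresCategory.HFun (Fin (m + 1)))
    (L R : J ⥤ Fin (m + 1)) (h : ∀ i j, L.obj i ≤ R.obj j) :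
    R ⋙ z ⋙ SquaresCategory.HFun.precomp R ⟶ grid (z ⋙ quotSFunctor m) L R h where
  app i := projRow (z.obj (R.obj i)) (L.obj i) R (h i)
  naturality _ i' f := hFun_hom_ext fun j =>
    verMap_comp_quotProj (z.map (R.map f)) (leOfHom (L.map f)) (h i' j)

end Proj

section Quot

variable {J : Type} [Category.{0} J] {m : ℕ} {i i' : Fin (m + 1)} {R : J ⥤ Fin (m + 1)}

lemma isQuotient_row (A : W.SObj m) (h : ∀ j, i ≤ R.obj j) (x : Arrow J) :
    W.IsQuotient (horMap (row A i R h) x.hom)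
      (A.functor.map (raiseSource (h x.left) (leOfHom (R.map x.hom)))) :=
  isQuotient_map_raiseTarget A (h x.left) (leOfHom (R.map x.hom))

/-- The isomorphism `A_{i, R k} / A_{i, R j} ⟶ A_{R j, R k}`. -/
noncomputable def quotRowApp (A : W.SObj m) (h : ∀ j, i ≤ R.obj j) (x : Arrow J) :
    (quotDiagram (row A i R h)).obj x ⟶ A.functor.obj (R.mapArrow.obj x) :=
  (isQuotient_quotProj (row A i R h) x).map (isQuotient_row A h x) (𝟙 _) (𝟙 _)
    ((Category.comp_id _).trans (Category.id_comp _).symm)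

lemma quotProj_comp_quotRowApp (A : W.SObj m) (h : ∀ j, i ≤ R.obj j) (x : Arrow J) :
    quotProj (row A i R h) x ≫ quotRowApp A h x =
      A.functor.map (raiseSource (h x.left) (leOfHom (R.map x.hom))) :=
  ((isQuotient_quotProj (row A i R h) x).comp_map _ _ _ _).trans (Category.id_comp _)

lemma weq_quotRowApp (A : W.SObj m) (h : ∀ j, i ≤ R.obj j) (x : Arrow J) :
    W.weq (quotRowApp A h x) := by
  have : IsIso (quotRowApp A h x) :=
    (isQuotient_quotProj (row A i R h) x).isIso_of_comp_eq (isQuotient_row A h x)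
      (quotProj_comp_quotRowApp A h x)
  exact W.weq_of_isIso _

lemma map_comp_quotRowApp (A : W.SObj m) (h : ∀ j, i ≤ R.obj j) {x y : Arrow J} (φ : x ⟶ y) :
    (quotDiagram (row A i R h)).map φ ≫ quotRowApp A h y =
      quotRowApp A h x ≫ A.functor.map (R.mapArrow.map φ) := by
  refine (isQuotient_quotProj (row A i R h) x).hom_ext ?_
  have hmap : horMap (row A i R h) φ.right = A.functor.map (raiseTarget (h x.right)
    (leOfHom (R.map φ.right))) := rfl
  rw [← Category.assoc, quotProj_comp_map, Category.assoc, quotProj_comp_quotRowApp,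
    ← Category.assoc, quotProj_comp_quotRowApp, hmap]
  refine (A.functor.map_comp _ _).symm.trans (Eq.trans ?_ (A.functor.map_comp _ _))
  exact congrArg _ (Subsingleton.elim _ _)

lemma quotApp_rowChange_comp_quotRowApp {A A' : W.SObj m} (α : A ⟶ A') (hi : i ≤ i')
    (h : ∀ j, i' ≤ R.obj j) (x : Arrow J) :
    quotApp (rowChange α hi h) x ≫ quotRowApp A' h x =
      quotRowApp A (fun j => hi.trans (h j)) x ≫
        (SObj.Hom.natTrans α).app (R.mapArrow.obj x) := by
  refine (isQuotient_quotProj (row A i R _) x).hom_ext ?_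
  have hverMap : verMap (rowChange α hi h) x.right = A.functor.map (raiseSource hi (h x.right)) ≫
    (SObj.Hom.natTrans α).app (arrowOfLE (h x.right)) := rfl
  rw [← Category.assoc, quotProj_comp_quotApp, Category.assoc, quotProj_comp_quotRowApp,
    ← Category.assoc, quotProj_comp_quotRowApp, hverMap]
  exact (Category.assoc _ _ _).trans
    (map_raiseSource_comp_natTrans α hi (h x.left) (leOfHom (R.map x.hom)))

end Quot

section QuotGrid

variable {n m : ℕ}

/-- The comparison of the quotients of a row of `A` with the corresponding part of `A`. -/
noncomputable def quotRow (A : W.SObj m) {i : Fin (m + 1)} (θ : Fin (n + 1) →o Fin (m + 1))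
    (h : ∀ j, i ≤ θ j) :
    quotSObj (row A i θ.monotone.functor h) ⟶ (SObj.precomp θ).obj A :=
  SObj.Hom.mk
    { app := fun x => quotRowApp A h x
      naturality := fun _ _ φ => map_comp_quotRowApp A h φ }
    (fun x => weq_quotRowApp A h x)

/-- The natural transformation from the quotients of the grid of a chain in `wS_• C` to the last
half of the chain. -/
noncomputable def quotGrid (z : Fin (m + 1) ⥤ W.SObj m) (L : Fin (n + 1) ⥤ Fin (m + 1))
    (θ : Fin (n + 1) →o Fin (m + 1)) (h : ∀ i j, L.obj i ≤ θ j) :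
    grid z L θ.monotone.functor h ⋙ quotSFunctor n ⟶
      θ.monotone.functor ⋙ z ⋙ SObj.precomp θ where
  app i := quotRow (z.obj (θ i)) θ (h i)
  naturality _ i' f := SObj.Hom.ext (NatTrans.ext (funext fun x =>
    quotApp_rowChange_comp_quotRowApp _ (leOfHom (L.map f)) (h i') x))

end QuotGrid

/-! ### The comparison maps -/

section BasePoint

lemma subsingleton_hom_of_eq_zero {A B : C} (hA : A = W.zero) : Subsingleton (A ⟶ B) := by
  subst hA
  exact ⟨W.isZero_zero.eq_of_src⟩

lemma obj_eq_zero (A : W.SObj 0) (x : Arrow (Fin 1)) : A.functor.obj x = W.zero := by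
  have hx : x = Arrow.mk (𝟙 0) := by
    obtain ⟨i, j, f⟩ := x
    obtain rfl := Subsingleton.elim i 0
    obtain rfl := Subsingleton.elim j 0
    rfl
  rw [hx]
  exact A.obj_diag 0

lemma eq_baseS₀ (A : W.SObj 0) : A = W.baseS₀ := by
  have h : A.functor = (Functor.const (Arrow (Fin 1))).obj W.zero := by
    refine Functor.hext (obj_eq_zero A) fun x y f => ?_
    have := subsingleton_hom_of_eq_zero (B := A.functor.obj y) (obj_eq_zero A x)
    refine Subsingleton.helim ?_ _ _
    rw [obj_eq_zero A x, obj_eq_zero A y]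
    rfl
  obtain ⟨F, _, _, _⟩ := A
  subst h
  rfl

lemma eq_baseT₀ (F : W.squaresCategory.HFun (Fin 1)) (h : horObj F 0 = W.zero) :
    F = W.squaresCategory.baseT₀ := by
  have hobj (i : Fin 1) : F.functor.obj i = W.zero := by
    obtain rfl := Subsingleton.elim i 0
    exact h
  have hF : F.functor = (Functor.const (Fin 1)).obj
      (show W.squaresCategory.Hor from W.squaresCategory.base) := by
    refine Functor.hext hobj fun x y f => ?_
    obtain rfl := Subsingleton.elim x y
    obtain rfl := Subsingleton.elim f (𝟙 x)
    rw [CategoryTheory.Functor.map_id, CategoryTheory.Functor.map_id, hobj x]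
    rfl
  obtain ⟨F⟩ := F
  subst hF
  rfl

lemma arrow_eq_id_baseS₀ {A B : W.SObj 0} (f : A ⟶ B) :
    Arrow.mk f = Arrow.mk (𝟙 (show W.SObj 0 from W.baseS₀)) := by
  obtain rfl := eq_baseS₀ A
  obtain rfl := eq_baseS₀ B
  exact congrArg Arrow.mk (SObj.Hom.ext (NatTrans.ext (funext fun _ =>
    W.isZero_zero.eq_of_src _ _)))

lemma arrow_eq_id_baseT₀ {F G : W.squaresCategory.HFun (Fin 1)} (f : F ⟶ G)
    (hF : horObj F 0 = W.zero) (hG : horObj G 0 = W.zero) :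
    Arrow.mk f = Arrow.mk (𝟙 (show W.squaresCategory.HFun (Fin 1) from
      W.squaresCategory.baseT₀)) := by
  obtain rfl := eq_baseT₀ F hF
  obtain rfl := eq_baseT₀ G hG
  exact congrArg Arrow.mk (hFun_hom_ext fun _ => W.isZero_zero.eq_of_src _ _)

end BasePoint

section Comparison

open Realization EdgewiseSubdivision SimplicialCat

variable (W)

/-- The map from the edgewise subdivision of `wS_• C` to `T_• C'` given by the grids with entries
`A_{l, r}`, for `l` in the first and `r` in the last half of `[n] * [n]`. -/
def sdGrid : sd (diagNerve W.wS) ⟶ diagNerve W.squaresCategory.T :=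
  sdDesc (fun z l r h => grid z (homFunctor l) (homFunctor r) h) (fun _ _ _ _ _ => rfl)
    fun _ _ _ _ _ => rfl

/-- The transformation from the last half to the grid of quotients, on the edgewise subdivision of
`T_• C'`. -/
noncomputable def sdProjGrid : sd (diagNerve W.squaresCategory.T) ⟶
    diagNerve (arrows.{v, u} W.squaresCategory.T) :=
  sdDesc (fun z l r h => arrowFunctor (projGrid z (homFunctor l) (homFunctor r) h))
    (fun _ _ _ _ _ => rfl) fun _ _ _ _ _ => rfl

/-- The transformation from the quotients of the grid to the last half, on the edgewise subdivision
of `wS_• C`. -/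
noncomputable def sdQuotGrid : sd (diagNerve W.wS) ⟶ diagNerve (arrows.{v, u} W.wS) :=
  sdDesc (fun z l r h => arrowFunctor (quotGrid z (homFunctor l) r.toOrderHom h))
    (fun _ _ _ _ _ => rfl) fun _ _ _ _ _ => rfl

lemma sdProjGrid_comp_arrowsSource :
    sdProjGrid W ≫ diagNerveMap (arrowsSource.{v, u} W.squaresCategory.T) = sdLast _ := rfl

lemma sdProjGrid_comp_arrowsTarget :
    sdProjGrid W ≫ diagNerveMap (arrowsTarget.{v, u} W.squaresCategory.T) =
      sdMap (diagNerveMap (quotT W)) ≫ sdGrid W := rfl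

lemma sdQuotGrid_comp_arrowsSource :
    sdQuotGrid W ≫ diagNerveMap (arrowsSource.{v, u} W.wS) =
      sdGrid W ≫ diagNerveMap (quotT W) := rfl

lemma sdQuotGrid_comp_arrowsTarget :
    sdQuotGrid W ≫ diagNerveMap (arrowsTarget.{v, u} W.wS) = sdLast _ := rfl

/-- The base vertex of `wS_• C`. -/
def vertexS : (diagNerve W.wS).obj (op ⦋0⦌) := ComposableArrows.mk₀ W.baseS₀

/-- The base vertex of `T_• C'`. -/
def vertexT : (diagNerve W.squaresCategory.T).obj (op ⦋0⦌) :=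
  ComposableArrows.mk₀ W.squaresCategory.baseT₀

lemma quotT_vertexT : (diagNerveMap (quotT W)).app _ (vertexT W) = vertexS W :=
  ComposableArrows.ext₀ (eq_baseS₀ _)

lemma sdGrid_vertexS : (sdGrid W).app _ (sdVertex (vertexS W)) = vertexT W :=
  ComposableArrows.ext₀ (eq_baseT₀ _ rfl)

lemma sdProjGrid_vertexT :
    (sdProjGrid W).app _ (sdVertex (vertexT W)) =
      (diagNerveMap (arrowsId W.squaresCategory.T)).app _ (vertexT W) :=
  ComposableArrows.ext₀ (arrow_eq_id_baseT₀ _ rfl (by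
    have : IsIso (𝟙 W.zero) := inferInstance
    exact quot_eq_zero (𝟙 W.zero) (W.cof_of_isIso _)))

lemma sdQuotGrid_vertexS :
    (sdQuotGrid W).app _ (sdVertex (vertexS W)) =
      (diagNerveMap (arrowsId W.wS)).app _ (vertexS W) :=
  ComposableArrows.ext₀ (arrow_eq_id_baseS₀ _)

/-- The map `|wS_• C| ⟶ |T_• C'|` given by the grids of a diagram. -/
noncomputable def rowMap : C(realization W.wS, realization W.squaresCategory.T) :=
  (map (sdGrid W)).comp (subdivision _)

/-- The map `|T_• C'| ⟶ |wS_• C|` forming quotients. -/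
noncomputable def quotMap : C(realization W.squaresCategory.T, realization W.wS) :=
  map (diagNerveMap (quotT W))

lemma rowMap_basePoint : rowMap W W.basePoint = W.squaresCategory.basePoint := by
  have h := congrArg (map (sdGrid W)) (subdivision_vertexPoint (vertexS W))
  rw [map_vertexPoint, sdGrid_vertexS] at h
  exact h

lemma quotMap_basePoint : quotMap W W.squaresCategory.basePoint = W.basePoint := by
  have h := map_vertexPoint (diagNerveMap (quotT W)) (vertexT W)
  rw [quotT_vertexT] at h
  exact h

lemma quotMap_comp_rowMap_homotopicRel_id :
    HomotopicRel ((quotMap W).comp (rowMap W)) (ContinuousMap.id _) {W.basePoint} := by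
  have hgrid := homotopicRel_of_arrows (sdQuotGrid W) (sdQuotGrid_vertexS W)
  rw [sdQuotGrid_comp_arrowsSource, sdQuotGrid_comp_arrowsTarget, map_comp] at hgrid
  exact (homotopicRel_comp_right hgrid (subdivision _)
    (Set.mapsTo_singleton.2 (subdivision_vertexPoint (vertexS W)))).trans
      (sdLast_comp_subdivision_homotopicRel_id (vertexS W))

lemma rowMap_comp_quotMap_homotopicRel_id :
    HomotopicRel ((rowMap W).comp (quotMap W)) (ContinuousMap.id _)
      {W.squaresCategory.basePoint} := by
  have hgrid := homotopicRel_of_arrows (sdProjGrid W) (sdProjGrid_vertexT W)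
  rw [sdProjGrid_comp_arrowsSource, sdProjGrid_comp_arrowsTarget, map_comp] at hgrid
  have hsub := homotopicRel_comp_right hgrid (subdivision _)
    (Set.mapsTo_singleton.2 (subdivision_vertexPoint (vertexT W)))
  rw [ContinuousMap.comp_assoc, ← subdivision_naturality] at hsub
  exact hsub.symm.trans (sdLast_comp_subdivision_homotopicRel_id (vertexT W))

end Comparison

end WaldhausenCategory

/-- The Waldhausen K-theory space `Ω|wS_• C|` is homotopy equivalent, as a loop space, to the
K-theory space `Ω_O|N_• T_• C'|` of the associated squares category `C'`: there is a homotopy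
equivalence that is obtained by looping a based map `|wS_• C| ⟶ |N_• T_• C'|`. -/
theorem mainTheorem6 {C : Type u} [Category.{v} C] (W : WaldhausenCategory C) :
    ∃ (e : W.K ≃ₕ W.squaresCategory.K)
      (φ : C(SimplicialCat.realization W.wS, SimplicialCat.realization W.squaresCategory.T)),
      φ W.basePoint = W.squaresCategory.basePoint ∧
        ∀ (γ : W.K) (t : unitInterval), e γ t = φ (γ t) := by
  let rowLoop : C(W.K, W.squaresCategory.K) := loopMap W.rowMap W.rowMap_basePoint
  let quotLoop : C(W.squaresCategory.K, W.K) := loopMap W.quotMap W.quotMap_basePoint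
  have hleft : (quotLoop.comp rowLoop).Homotopic (ContinuousMap.id _) :=
    loopMap_homotopic (f := W.quotMap.comp W.rowMap) (g := ContinuousMap.id _)
      ((congrArg W.quotMap W.rowMap_basePoint).trans W.quotMap_basePoint) rfl
      W.quotMap_comp_rowMap_homotopicRel_id
  have hright : (rowLoop.comp quotLoop).Homotopic (ContinuousMap.id _) :=
    loopMap_homotopic (f := W.rowMap.comp W.quotMap) (g := ContinuousMap.id _)
      ((congrArg W.rowMap W.quotMap_basePoint).trans W.rowMap_basePoint) rfl
      W.rowMap_comp_quotMap_homotopicRel_id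
  exact ⟨⟨rowLoop, quotLoop, hleft, hright⟩, W.rowMap, W.rowMap_basePoint, fun _ _ => rfl⟩
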